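/- Let $d\ge 0$ be an integer, let $\Theta\subset\mathbb R^d$ be a bounded open set (for example a bounded Lipschitz domain), let $T>0$, and let $H^1_0(\Theta)$ be the closure of $C_c^\infty(\Theta)$ in $H^1(\Theta)$, with dual $H^1_0(\Theta)^*$. Let $(\cdot,\cdot)$ be the inner product of $L^2(\Theta)$ (and of $L^2(\Theta)^d$) and $\langle\cdot,\cdot\rangle$ the duality pairing of $H^1_0(\Theta)^*$ and $H^1_0(\Theta)$, and embed $L^2(\Theta)$ in $H^1_0(\Theta)^*$ by $u\mapsto(u,\cdot)$. Assume that - $\mu\in L^\infty(0,T)$ and $0\le\mu(t)\le\bar\mu$ for a.e. $t$, with a constant $\bar\mu<1$; - $\rho,\beta\in L^\infty(\Theta\times(0,T))$, $\beta\ge\tilde\beta_0$ a.e. in $\Theta\times(0,T)$ with a constant $\tilde\beta_0>0$, and the weak derivative $\partial_t\beta$ exists and lies in $L^\infty(\Theta\times(0,T))$; - $f:\mathbb R\to\mathbb R$ is Lipschitz continuous and $Q\in C([0,T],L^2(\Theta))$; - $\tilde\Phi_0,\tilde\Psi_0\in L^2(\Theta)$. For $t\in(0,T)$ write $$\partial_t^{\mu(t)}\Phi(t)=\frac1{\Gamma(1-\mu(t))}\int_0^t\frac{\partial_t\Phi(r)}{(t-r)^{\mu(t)}}\,dr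 .$$ **Theorem (uniqueness of a weak solution).** There is at most one function $\Phi\in C([0,T],L^2(\Theta))\cap L^2(0,T;H^1_0(\Theta))$ with weak time derivatives $\partial_t\Phi\in L^2(0,T;H^1_0(\Theta))\cap C([0,T],L^2(\Theta))$ and $\partial_{tt}\Phi\in L^2(0,T;H^1_0(\Theta)^*)$ that satisfies $\Phi(0)=\tilde\Phi_0$, $\partial_t\Phi(0)=\tilde\Psi_0$ and, for all $\chi\in H^1_0(\Theta)$ and a.e. $t\in(0,T)$, $$\langle\partial_{tt}\Phi(t),\chi\rangle+\big(\rho(t)\,\partial_t^{\mu(t)}\Phi(t),\chi\big)+\big(\beta(t)\nabla\Phi(t),\nabla\chi\big)=\big(f(\Phi(t)),\chi\big)+\big(Q(t),\chi\big).$$ That is, any two such functions coincide in $L^2(\Theta)$ for every $t\in[0,T]$. -/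

import Mathlib

open MeasureTheory Set

noncomputable section

/-- The Lebesgue space `L²(Θ)` of real functions. -/
abbrev L2 {d : ℕ} (Θ : Set (EuclideanSpace ℝ (Fin d))) : Type :=
  Lp ℝ 2 (volume.restrict Θ)

/-- The Lebesgue space `L²(Θ)^d` of vector fields. -/
abbrev L2Vec {d : ℕ} (Θ : Set (EuclideanSpace ℝ (Fin d))) : Type :=
  Lp (EuclideanSpace ℝ (Fin d)) 2 (volume.restrict Θ)

/-- `φ` is a test function on the set `A`, i.e. `φ ∈ C_c^∞(A)`. -/
def IsTestFunction {E : Type*} [NormedAddCommGroup E] [NormedSpace ℝ E]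
    (A : Set E) (φ : E → ℝ) : Prop :=
  ContDiff ℝ (⊤ : ℕ∞) φ ∧ HasCompactSupport φ ∧ tsupport φ ⊆ A

/-- The pairs `(φ, ∇φ)` with `φ ∈ C_c^∞(Θ)`, in `L²(Θ) × L²(Θ)^d`. -/
def testPairs {d : ℕ} (Θ : Set (EuclideanSpace ℝ (Fin d))) :
    Set (WithLp 2 (L2 Θ × L2Vec Θ)) :=
  {w | ∃ φ : EuclideanSpace ℝ (Fin d) → ℝ, IsTestFunction Θ φ ∧
    (w.fst : EuclideanSpace ℝ (Fin d) → ℝ) =ᵐ[volume.restrict Θ] φ ∧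
    (w.snd : EuclideanSpace ℝ (Fin d) → EuclideanSpace ℝ (Fin d))
      =ᵐ[volume.restrict Θ] fun x => gradient φ x}

/-- The Sobolev space `H¹₀(Θ)`, as a subspace: the closure of `C_c^∞(Θ)` for the norm
`(‖u‖² + ‖∇u‖²)^(1/2)`. A function `u` is represented by the pair `(u, ∇u)`, which identifies
`H¹(Θ)` with a closed subspace of `L²(Θ) × L²(Θ)^d`; the closure can thus be taken there. -/
def H10Submodule {d : ℕ} (Θ : Set (EuclideanSpace ℝ (Fin d))) :
    Submodule ℝ (WithLp 2 (L2 Θ × L2Vec Θ)) :=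
  (Submodule.span ℝ (testPairs Θ)).topologicalClosure

/-- The Sobolev space `H¹₀(Θ)` with the inner product `(u, v) + (∇u, ∇v)`. -/
def H10 {d : ℕ} (Θ : Set (EuclideanSpace ℝ (Fin d))) : Type := ↥(H10Submodule Θ)

instance {d : ℕ} (Θ : Set (EuclideanSpace ℝ (Fin d))) : NormedAddCommGroup (H10 Θ) :=
  inferInstanceAs (NormedAddCommGroup ↥(H10Submodule Θ))

instance {d : ℕ} (Θ : Set (EuclideanSpace ℝ (Fin d))) : InnerProductSpace ℝ (H10 Θ) :=
  inferInstanceAs (InnerProductSpace ℝ ↥(H10Submodule Θ))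

instance {d : ℕ} (Θ : Set (EuclideanSpace ℝ (Fin d))) : CompleteSpace (H10 Θ) :=
  (Submodule.isClosed_topologicalClosure (Submodule.span ℝ (testPairs Θ))).completeSpace_coe

/-- The embedding `H¹₀(Θ) → L²(Θ)`. -/
def H10.toL2 {d : ℕ} (Θ : Set (EuclideanSpace ℝ (Fin d))) : H10 Θ →L[ℝ] L2 Θ :=
  (WithLp.fstL 2 ℝ (L2 Θ) (L2Vec Θ)).comp (H10Submodule Θ).subtypeL

/-- The weak gradient `H¹₀(Θ) → L²(Θ)^d`. -/
def H10.grad {d : ℕ} (Θ : Set (EuclideanSpace ℝ (Fin d))) : H10 Θ →L[ℝ] L2Vec Θ :=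
  (WithLp.sndL 2 ℝ (L2 Θ) (L2Vec Θ)).comp (H10Submodule Θ).subtypeL

/-- The embedding `L²(Θ) → H¹₀(Θ)*`, `u ↦ (v ↦ (u, v))`. -/
def L2.toDual {d : ℕ} {Θ : Set (EuclideanSpace ℝ (Fin d))} (u : L2 Θ) :
    StrongDual ℝ (H10 Θ) :=
  (innerSL ℝ u).comp (H10.toL2 Θ)

/-- `v` is the weak (distributional) derivative on `(0,T)` of the Banach-space-valued
function `u`. -/
def HasWeakTimeDeriv {X : Type*} [NormedAddCommGroup X] [NormedSpace ℝ X]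
    (T : ℝ) (u v : ℝ → X) : Prop :=
  LocallyIntegrableOn u (Ioo 0 T) ∧ LocallyIntegrableOn v (Ioo 0 T) ∧
    ∀ φ : ℝ → ℝ, IsTestFunction (Ioo 0 T) φ →
      ∫ t in Ioo 0 T, deriv φ t • u t = -∫ t in Ioo 0 T, φ t • v t

/-- `b` is the weak (distributional) partial derivative in time of `β` on `Θ × (0,T)`. -/
def HasWeakPartialTimeDeriv {d : ℕ} (Θ : Set (EuclideanSpace ℝ (Fin d))) (T : ℝ)
    (β b : EuclideanSpace ℝ (Fin d) × ℝ → ℝ) : Prop :=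
  ∀ φ : EuclideanSpace ℝ (Fin d) × ℝ → ℝ, IsTestFunction (Θ ×ˢ Ioo 0 T) φ →
    ∫ p in Θ ×ˢ Ioo 0 T, β p * deriv (fun s => φ (p.1, s)) p.2
      = -∫ p in Θ ×ˢ Ioo 0 T, b p * φ p

/-- The space `L^∞(Θ × (0,T))`. -/
def IsLinfty {d : ℕ} (Θ : Set (EuclideanSpace ℝ (Fin d))) (T : ℝ)
    (g : EuclideanSpace ℝ (Fin d) × ℝ → ℝ) : Prop :=
  MemLp g ⊤ (volume.restrict (Θ ×ˢ Ioo 0 T))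

/-- The Caputo derivative of variable order `μ(t)` at time `t` of a function with time
derivative `Ψ`: `Γ(1 - μ(t))⁻¹ ∫₀ᵗ (t - r)^(-μ(t)) Ψ(r) dr`. -/
def caputo {X : Type*} [NormedAddCommGroup X] [NormedSpace ℝ X]
    (μ : ℝ → ℝ) (Ψ : ℝ → X) (t : ℝ) : X :=
  (Real.Gamma (1 - μ t))⁻¹ • ∫ r in (0 : ℝ)..t, ((t - r) ^ (-μ t)) • Ψ r

/-- `Φ` is a weak solution of
`∂ₜₜΦ + ρ ∂ₜ^{μ(t)} Φ = ∇·(β ∇Φ) + f(Φ) + Q` in `Θ × (0,T]`, `Φ = 0` on `∂Θ × (0,T]`,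
`Φ(0) = Φ₀`, `∂ₜΦ(0) = Ψ₀`, in the class
`Φ ∈ C([0,T], L²) ∩ L²(0,T; H¹₀)`, `∂ₜΦ ∈ L²(0,T; H¹₀) ∩ C([0,T], L²)`,
`∂ₜₜΦ ∈ L²(0,T; H¹₀*)`.
Here `U` is `Φ` as an `H¹₀`-valued function, `Ψ` is the `L²`-continuous version of `∂ₜΦ`,
`V` is `∂ₜΦ` as an `H¹₀`-valued function, and `W` is `∂ₜₜΦ`. -/
def IsWeakSolution {d : ℕ} (Θ : Set (EuclideanSpace ℝ (Fin d))) (T : ℝ)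
    (μ : ℝ → ℝ) (ρ β : EuclideanSpace ℝ (Fin d) × ℝ → ℝ) (f : ℝ → ℝ) (Q : ℝ → L2 Θ)
    (Φ₀ Ψ₀ : L2 Θ) (Φ : ℝ → L2 Θ) : Prop :=
  ∃ (U V : ℝ → H10 Θ) (Ψ : ℝ → L2 Θ) (W : ℝ → StrongDual ℝ (H10 Θ)),
    (ContinuousOn Φ (Icc 0 T) ∧ MemLp U 2 (volume.restrict (Ioo 0 T)) ∧
      ∀ᵐ t ∂volume.restrict (Ioo 0 T), H10.toL2 Θ (U t) = Φ t) ∧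
    (HasWeakTimeDeriv T Φ Ψ ∧ ContinuousOn Ψ (Icc 0 T) ∧
      MemLp V 2 (volume.restrict (Ioo 0 T)) ∧
      ∀ᵐ t ∂volume.restrict (Ioo 0 T), H10.toL2 Θ (V t) = Ψ t) ∧
    (HasWeakTimeDeriv T (fun t => L2.toDual (Ψ t)) W ∧
      MemLp W 2 (volume.restrict (Ioo 0 T))) ∧
    (Φ 0 = Φ₀ ∧ Ψ 0 = Ψ₀) ∧
    ∀ χ : H10 Θ, ∀ᵐ t ∂volume.restrict (Ioo 0 T),
      W t χ
        + (∫ x in Θ, ρ (x, t) * (caputo μ Ψ t) x * (H10.toL2 Θ χ) x)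
        + (∫ x in Θ, β (x, t) * inner ℝ ((H10.grad Θ (U t)) x) ((H10.grad Θ χ) x))
      = (∫ x in Θ, f ((Φ t) x) * (H10.toL2 Θ χ) x)
        + ∫ x in Θ, (Q t) x * (H10.toL2 Θ χ) x

end

/-! ### Energy inequalities and abstract uniqueness. -/

section

open Filter Topology

/-! The difference of two solutions has velocity `ψ`, which takes values in `H¹₀` for a.e. time. The
equation may therefore be tested with the velocity itself, which gives the usual energy balance for
`‖ψ‖² + (β∇φ, ∇φ)`, where `φ` is the difference of the solutions.

Two points need care. First, `ψ'` lies only in the dual space, so the chain rule for `‖ψ‖²` is not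
immediate. `norm_sq_le_of_weak_equation` works with the time-integrated equation instead: testing on
`[t, t + h]` with `v(t) + v(t + h)` produces exactly `‖ψ(t + h)‖² - ‖ψ(t)‖²`, and averaging over `t`
and letting `h → 0` gives the inequality. The companion estimate `inner_apply_self_le_of_lipschitz`
handles the elliptic part and needs the coefficient to be Lipschitz in time. When the two are added,
the cross terms `(β∇φ, ∇v)` cancel.

Second, the Caputo term has memory. Since `μ ≤ μbar < 1`, its kernel has uniformly bounded mass, so
at time `t` the term is bounded by a constant times any monotone majorant of `‖ψ‖` at `t`. The
Lipschitz term is treated alike, as `φ` is the primitive of `ψ`. `eq_zero_of_weak_equation` closes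
the estimate in an exponentially weighted norm: the majorant is `√(a exp(mt))`, with `a` the
weighted maximum of the energy, and a large `m` yields `a ≤ a / 2`, hence `a = 0`.

The remaining work turns the weak hypotheses into this setting. The du Bois-Reymond lemma makes
functions primitives of their weak derivatives; applied to integrals over sets in space, it gives
`β` a representative Lipschitz in time. Injectivity of `H¹₀ → L²` identifies the `H¹₀`-valued
difference of solutions with the primitive of the `H¹₀`-valued velocity. -/

theorem Continuous.exists_pos_forall_norm_sub_le {X : Type*} [NormedAddCommGroup X] {F : ℝ → X}
    (hF : Continuous F) (a b : ℝ) {ε : ℝ} (hε : 0 < ε) :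
    ∃ δ > 0, ∀ s ∈ Icc a b, ∀ t ∈ Icc a b, |s - t| ≤ δ → ‖F s - F t‖ ≤ ε := by
  have h := isCompact_Icc.uniformContinuousOn_of_continuous (hF.continuousOn (s := Icc a b))
  obtain ⟨δ, hδ, h⟩ := Metric.uniformContinuousOn_iff.1 h ε hε
  refine ⟨δ / 2, half_pos hδ, fun s hs t ht hst => ?_⟩
  have := h s hs t ht (by rw [Real.dist_eq]; linarith)
  rw [dist_eq_norm] at this
  exact this.le

/-- A function whose increments are uniformly small compared with those of an integral does not
increase. -/
theorem le_of_forall_sub_le_mul_integral {g κ : ℝ → ℝ} {τ : ℝ} (hτ : 0 ≤ τ) (hκ : Integrable κ)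
    (h : ∀ ε > 0, ∃ δ > 0, ∀ s t, 0 ≤ s → s ≤ t → t ≤ τ → t - s ≤ δ →
      g t - g s ≤ ε * ∫ r in s..t, κ r) : g τ ≤ g 0 := by
  have key : ∀ ε > 0, g τ - g 0 ≤ ε * ∫ r in (0 : ℝ)..τ, κ r := by
    intro ε hε
    obtain ⟨δ, hδ, h⟩ := h ε hε
    obtain ⟨n, hn⟩ := exists_nat_gt (τ / δ)
    have hn0 : (0 : ℝ) < n := lt_of_le_of_lt (by positivity) hn
    -- Equal partition of mesh at most `δ`. The increments of `g` telescope and the integrals add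
    -- up, so the error stays proportional to `ε`.
    set a : ℕ → ℝ := fun i => i * (τ / n) with ha
    have h1 : ∀ i ∈ Finset.range n, g (a (i + 1)) - g (a i) ≤ ε * ∫ r in a i..a (i + 1), κ r := by
      intro i hi
      have hi' : ((i : ℝ) + 1) ≤ n := by exact_mod_cast Finset.mem_range.1 hi
      have hpos : 0 ≤ τ / n := by positivity
      refine h _ _ (by positivity) ?_ ?_ ?_
      · simp only [ha, Nat.cast_add, Nat.cast_one]; linarith
      · simp only [ha, Nat.cast_add, Nat.cast_one]
        calc ((i : ℝ) + 1) * (τ / n) ≤ n * (τ / n) := by gcongr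
          _ = τ := by field_simp
      · simp only [ha, Nat.cast_add, Nat.cast_one]
        have : τ / n ≤ δ := by
          rw [div_lt_iff₀ hδ] at hn
          rw [div_le_iff₀ hn0]; linarith
        linarith
    have h2 := Finset.sum_le_sum h1
    rw [Finset.sum_range_sub (fun i => g (a i)), ← Finset.mul_sum,
      intervalIntegral.sum_integral_adjacent_intervals
        (fun k _ => hκ.intervalIntegrable)] at h2
    have e1 : a n = τ := by simp only [ha]; field_simp
    have e0 : a 0 = 0 := by simp [ha]
    rwa [e0, e1] at h2
  have hlim : Tendsto (fun ε : ℝ => ε * ∫ r in (0 : ℝ)..τ, κ r) (𝓝[>] 0)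
      (𝓝 (0 * ∫ r in (0 : ℝ)..τ, κ r)) :=
    (tendsto_id.mul_const _).mono_left nhdsWithin_le_nhds
  rw [zero_mul] at hlim
  have := ge_of_tendsto hlim (eventually_nhdsWithin_of_forall key)
  linarith

section Abstract

variable {K : Type*} [NormedAddCommGroup K] [InnerProductSpace ℝ K]

theorem continuous_primitive_of_integrable {z : ℝ → K} (hz : Integrable z) :
    Continuous fun t => ∫ r in (0 : ℝ)..t, z r :=
  intervalIntegral.continuous_primitive (fun _ _ => hz.intervalIntegrable) 0

theorem continuous_of_norm_sub_le {X : Type*} [NormedAddCommGroup X] {A : ℝ → X} {M : ℝ}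
    (hA : ∀ s t, ‖A t - A s‖ ≤ M * |t - s|) : Continuous A := by
  have : LipschitzWith M.toNNReal A := LipschitzWith.of_dist_le_mul fun t s => by
    rw [dist_eq_norm, Real.dist_eq]
    exact (hA s t).trans (by gcongr; exact Real.le_coe_toNNReal M)
  exact this.continuous

theorem intervalIntegrable_inner_of_continuous {G z : ℝ → K} (hG : Continuous G)
    (hz : Integrable z) (s t : ℝ) :
    IntervalIntegrable (fun r => inner ℝ (G r) (z r)) volume s t := by
  obtain ⟨C, hC⟩ := isCompact_uIcc.exists_bound_of_continuousOn (hG.continuousOn (s := uIcc s t))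
  refine (hz.norm.const_mul C).intervalIntegrable.mono_fun'
    (hG.aestronglyMeasurable.inner hz.aestronglyMeasurable.restrict) ?_
  refine (ae_restrict_iff' measurableSet_uIoc).2 (ae_of_all _ fun r hr => ?_)
  refine (norm_inner_le_norm _ _).trans ?_
  exact mul_le_mul_of_nonneg_right (hC r (uIoc_subset_uIcc hr)) (norm_nonneg _)

/-- The energy inequality for a family of symmetric operators depending Lipschitz continuously
on time. -/
theorem inner_apply_self_le_of_lipschitz [CompleteSpace K] {A : ℝ → K →L[ℝ] K} {M : ℝ} (hM : 0 ≤ M)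
    (hA : ∀ s t, ‖A t - A s‖ ≤ M * |t - s|)
    (hsymm : ∀ t x y, inner ℝ (A t x) y = inner ℝ x (A t y))
    {z y : ℝ → K} (hz : Integrable z) (hy : ∀ t, y t = ∫ r in (0 : ℝ)..t, z r) {τ : ℝ}
    (hτ : 0 ≤ τ) :
    inner ℝ (A τ (y τ)) (y τ) ≤
      2 * (∫ r in (0 : ℝ)..τ, inner ℝ (A r (y r)) (z r)) + M * ∫ r in (0 : ℝ)..τ, ‖y r‖ ^ 2 := by
  have hyc : Continuous y := by
    rw [show y = fun t => ∫ r in (0 : ℝ)..t, z r from funext hy]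
    exact continuous_primitive_of_integrable hz
  have hAc : Continuous A := continuous_of_norm_sub_le hA
  have hGc : Continuous fun r => A r (y r) := hAc.clm_apply hyc
  have hnc : Continuous fun r => ‖y r‖ ^ 2 := by fun_prop
  have hint := intervalIntegrable_inner_of_continuous hGc hz
  have hint2 : ∀ s t, IntervalIntegrable (fun r => ‖y r‖ ^ 2) volume s t :=
    fun s t => hnc.intervalIntegrable s t
  -- The defect of the claimed inequality, which vanishes at `0`; it suffices that it does not
  -- increase.
  set g : ℝ → ℝ := fun t => inner ℝ (A t (y t)) (y t)
    - 2 * (∫ r in (0 : ℝ)..t, inner ℝ (A r (y r)) (z r)) - M * ∫ r in (0 : ℝ)..t, ‖y r‖ ^ 2 with hg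
  have hy0 : y 0 = 0 := by rw [hy]; simp
  have main : g τ ≤ g 0 := by
    -- The summand `‖z‖` absorbs the errors paired with `z`, the indicator those in `M ‖y‖²`; the
    -- cut-off to `[0, τ]` keeps `κ` integrable.
    set κ : ℝ → ℝ := fun r => ‖z r‖ + (Icc 0 τ).indicator (fun _ => (1 : ℝ)) r with hκ
    have hκi : Integrable κ := hz.norm.add
      ((integrable_indicator_iff measurableSet_Icc).2
        (integrableOn_const (by simp)))
    obtain ⟨Y, hY⟩ := (isCompact_Icc (a := (0 : ℝ)) (b := τ)).exists_bound_of_continuousOn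
      hyc.continuousOn
    have hY0 : 0 ≤ Y := (norm_nonneg _).trans (hY 0 ⟨le_rfl, hτ⟩)
    refine le_of_forall_sub_le_mul_integral hτ hκi fun ε hε => ?_
    obtain ⟨δ₁, hδ₁, h₁⟩ := hGc.exists_pos_forall_norm_sub_le 0 τ (show 0 < ε / 3 by positivity)
    obtain ⟨δ₂, hδ₂, h₂⟩ := hnc.exists_pos_forall_norm_sub_le 0 τ
      (show 0 < ε / (M + 1) by positivity)
    refine ⟨min δ₁ (min δ₂ (ε / 3 / (M * Y + 1))), by positivity, fun s t hs hst ht hδ => ?_⟩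
    have hd₁ := hδ.trans (min_le_left _ _)
    have hd₂ := hδ.trans ((min_le_right _ _).trans (min_le_left _ _))
    have hd₃ := hδ.trans ((min_le_right _ _).trans (min_le_right _ _))
    have hsI : s ∈ Icc 0 τ := ⟨hs, hst.trans ht⟩
    have htI : t ∈ Icc 0 τ := ⟨hs.trans hst, ht⟩
    have hd : y t - y s = ∫ r in s..t, z r := by
      rw [hy, hy, intervalIntegral.integral_interval_sub_left] <;> exact hz.intervalIntegrable
    have hP : (∫ r in (0 : ℝ)..t, inner ℝ (A r (y r)) (z r)) -
        (∫ r in (0 : ℝ)..s, inner ℝ (A r (y r)) (z r)) =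
        ∫ r in s..t, inner ℝ (A r (y r)) (z r) :=
      intervalIntegral.integral_interval_sub_left (hint _ _) (hint _ _)
    have hN : (∫ r in (0 : ℝ)..t, ‖y r‖ ^ 2) - (∫ r in (0 : ℝ)..s, ‖y r‖ ^ 2) =
        ∫ r in s..t, ‖y r‖ ^ 2 :=
      intervalIntegral.integral_interval_sub_left (hint2 _ _) (hint2 _ _)
    set w := A s (y t + y s) with hw
    have hzi : IntervalIntegrable z volume s t := hz.intervalIntegrable
    have hwi : IntervalIntegrable (fun r => inner ℝ w (z r)) volume s t :=
      intervalIntegrable_inner_of_continuous continuous_const hz s t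
    have hci : IntervalIntegrable (fun _ => M * ‖y t‖ ^ 2) volume s t :=
      intervalIntegrable_const
    have hI : inner ℝ w (y t - y s) = ∫ r in s..t, inner ℝ w (z r) := by
      rw [hd]
      exact ((innerSL ℝ w).intervalIntegral_comp_comm hzi).symm
    -- Difference of squares for the form of `A s`; this is where symmetry enters.
    have hE : inner ℝ (A t (y t)) (y t) - inner ℝ (A s (y s)) (y s) =
        inner ℝ ((A t - A s) (y t)) (y t) + inner ℝ w (y t - y s) := by
      have h3 := hsymm s (y s) (y t)
      simp only [hw, _root_.sub_apply, map_add, inner_add_left, inner_sub_left,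
        inner_sub_right]
      rw [real_inner_comm (A s (y t)) (y s)] at h3
      linarith
    have hT : inner ℝ ((A t - A s) (y t)) (y t) ≤ ∫ r in s..t, M * ‖y t‖ ^ 2 := by
      rw [intervalIntegral.integral_const, smul_eq_mul]
      refine (real_inner_le_norm _ _).trans ?_
      have := (A t - A s).le_of_opNorm_le (hA s t) (y t)
      rw [abs_of_nonneg (by linarith)] at this
      calc _ ≤ M * (t - s) * ‖y t‖ * ‖y t‖ := by gcongr
        _ = _ := by ring
    have hrepr : g t - g s ≤ ∫ r in s..t, (M * ‖y t‖ ^ 2 + inner ℝ w (z r)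
        - 2 * inner ℝ (A r (y r)) (z r) - M * ‖y r‖ ^ 2) := by
      rw [intervalIntegral.integral_sub, intervalIntegral.integral_sub,
        intervalIntegral.integral_add,
        intervalIntegral.integral_const_mul 2, intervalIntegral.integral_const_mul M fun r => ‖y r‖ ^ 2,
        ← hI, ← hP, ← hN]
      · simp only [hg]; linarith
      · exact hci
      · exact hwi
      · exact hci.add hwi
      · exact (hint s t).const_mul 2
      · exact (hci.add hwi).sub ((hint s t).const_mul 2)
      · exact (hint2 s t).const_mul M
    refine hrepr.trans ?_
    rw [← intervalIntegral.integral_const_mul]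
    refine intervalIntegral.integral_mono_on hst
      (((hci.add hwi).sub ((hint s t).const_mul 2)).sub
        ((hint2 s t).const_mul M)) (hκi.intervalIntegrable.const_mul ε) fun r hr => ?_
    have hrI : r ∈ Icc 0 τ := ⟨hs.trans hr.1, hr.2.trans ht⟩
    have e1 : κ r = ‖z r‖ + 1 := by simp [hκ, indicator_of_mem hrI]
    have n1 : ‖A t (y t) - A r (y r)‖ ≤ ε / 3 :=
      h₁ t htI r hrI (by rw [abs_of_nonneg (by linarith [hr.2])]; linarith [hr.1])
    have n2 : ‖A s (y s) - A r (y r)‖ ≤ ε / 3 :=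
      h₁ s hsI r hrI (by rw [abs_of_nonpos (by linarith [hr.1])]; linarith [hr.2])
    have n3 : ‖(A s - A t) (y t)‖ ≤ ε / 3 := by
      have := (A s - A t).le_of_opNorm_le (hA t s) (y t)
      rw [abs_of_nonpos (by linarith)] at this
      have hY' := hY t htI
      calc _ ≤ M * -(s - t) * ‖y t‖ := this
        _ ≤ M * (ε / 3 / (M * Y + 1)) * Y := by gcongr; linarith
        _ = ε / 3 * (M * Y / (M * Y + 1)) := by ring
        _ ≤ ε / 3 * 1 := by
          gcongr
          rw [div_le_one (by positivity)]; linarith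
        _ = _ := by ring
    have n4 : M * (‖y t‖ ^ 2 - ‖y r‖ ^ 2) ≤ ε := by
      have := h₂ t htI r hrI (by rw [abs_of_nonneg (by linarith [hr.2])]; linarith [hr.1])
      have := (le_abs_self _).trans this
      calc _ ≤ M * (ε / (M + 1)) := by gcongr
        _ = ε * (M / (M + 1)) := by ring
        _ ≤ ε * 1 := by
          gcongr
          rw [div_le_one (by positivity)]; linarith
        _ = _ := by ring
    -- Replacing `w` by `2 A r (y r)` costs three errors, each at most `ε / 3`: two by uniform
    -- continuity of `r ↦ A r (y r)`, one by the Lipschitz bound on `A`.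
    have e2 : inner ℝ w (z r) - 2 * inner ℝ (A r (y r)) (z r) =
        inner ℝ ((A t (y t) - A r (y r)) + (A s (y s) - A r (y r)) + (A s - A t) (y t)) (z r) := by
      simp only [hw, _root_.sub_apply, map_add, inner_add_left, inner_sub_left]
      ring
    have n5 : inner ℝ w (z r) - 2 * inner ℝ (A r (y r)) (z r) ≤ ε * ‖z r‖ := by
      rw [e2]
      refine (real_inner_le_norm _ _).trans ?_
      gcongr
      refine (norm_add₃_le).trans ?_
      linarith
    rw [e1]
    linarith
  have : g 0 = 0 := by simp [hg, hy0]
  rw [this] at main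
  simp only [hg] at main
  linarith

end Abstract

/-- The energy inequality for `ψ' = -D* G + O(k)` in the dual space, tested with `ψ = j v`. -/
theorem norm_sq_le_of_weak_equation {H L K : Type*}
    [NormedAddCommGroup H] [NormedSpace ℝ H]
    [NormedAddCommGroup L] [InnerProductSpace ℝ L]
    [NormedAddCommGroup K] [InnerProductSpace ℝ K]
    (j : H →L[ℝ] L) (D : H →L[ℝ] K) {T : ℝ} {v : ℝ → H} (hv : Integrable v)
    {ψ : ℝ → L} (hψ : Continuous ψ)
    (hjv : ∀ᵐ t, t ∈ Ioo 0 T → j (v t) = ψ t)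
    {G : ℝ → K} (hG : Continuous G) {k l : ℝ → ℝ} (hk : Continuous k) (hl : Continuous l)
    (hkm : Monotone k) (hlm : Monotone l) (hk0 : ∀ t, 0 ≤ k t)
    (hψl : ∀ t ∈ Icc 0 T, ‖ψ t‖ ≤ l t)
    (hweak : ∀ χ, ∀ s t, 0 ≤ s → s ≤ t → t ≤ T →
      inner ℝ (ψ t - ψ s) (j χ) ≤ ∫ r in s..t, (-inner ℝ (G r) (D χ) + k r * ‖j χ‖))
    {τ : ℝ} (hτ : 0 ≤ τ) (hτT : τ < T) :
    ‖ψ τ‖ ^ 2 ≤ ‖ψ 0‖ ^ 2 + 2 * (∫ r in (0 : ℝ)..τ, k r * l r)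
      - 2 * ∫ r in (0 : ℝ)..τ, inner ℝ (G r) (D (v r)) := by
  set z : ℝ → K := fun r => D (v r) with hz
  have hzi : Integrable z := D.integrable_comp hv
  have hGz := intervalIntegrable_inner_of_continuous hG hzi
  set p : ℝ → ℝ := fun r => inner ℝ (G r) (z r) with hp
  have hnc : Continuous fun r => ‖ψ r‖ ^ 2 := by fun_prop
  have hkl : Continuous fun r => k r * l r := hk.mul hl
  set N : ℝ → ℝ := fun t => ∫ r in (0 : ℝ)..t, ‖ψ r‖ ^ 2 with hN
  set P : ℝ → ℝ := fun t => ∫ r in (0 : ℝ)..t, p r with hP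
  set Z := ∫ r, ‖z r‖ with hZ
  have hPc : ContinuousOn P (Icc 0 T) := by
    have := intervalIntegral.continuousOn_primitive_interval
      (f := p) (a := 0) (b := T) (μ := volume) (by
        rw [uIcc_of_le (hτ.trans hτT.le)]
        exact (intervalIntegrable_iff_integrableOn_Icc_of_le (hτ.trans hτT.le)).1 (hGz 0 T))
    rwa [uIcc_of_le (hτ.trans hτT.le)] at this
  have key : ∀ ε > 0, ‖ψ τ‖ ^ 2 ≤ ‖ψ 0‖ ^ 2 + 2 * (∫ r in (0 : ℝ)..τ, k r * l r)
      - 2 * P τ + ε * (2 * Z) := by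
    intro ε hε
    obtain ⟨δ, hδ, hGδ⟩ := hG.exists_pos_forall_norm_sub_le 0 T hε
    have hstep : ∀ h ∈ Ioo 0 (min δ (T - τ)), N (τ + h) - N τ - N h ≤
        h * (2 * (∫ r in h..(τ + h), k r * l r) - (P (τ + h) - P h + P τ) + ε * (2 * Z)) := by
      rintro h ⟨h0, hh⟩
      have hhδ : h ≤ δ := (hh.trans_le (min_le_left _ _)).le
      have hhT : τ + h ≤ T := by linarith [hh.trans_le (min_le_right _ _)]
      have hjv' : ∀ᵐ t, t + h ∈ Ioo 0 T → j (v (t + h)) = ψ (t + h) :=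
        (measurePreserving_add_right volume h).quasiMeasurePreserving.ae hjv
      have hpt : ∀ᵐ t ∂volume.restrict (Icc 0 τ), ‖ψ (t + h)‖ ^ 2 - ‖ψ t‖ ^ 2 ≤
          h * (2 * (k (t + h) * l (t + h)) - (p (t + h) + p t) + ε * (‖z t‖ + ‖z (t + h)‖)) := by
        rw [ae_restrict_iff' measurableSet_Icc]
        filter_upwards [hjv, hjv', compl_mem_ae_iff.2 (measure_singleton (0 : ℝ))]
          with t ht1 ht2 ht0 ht
        have ht0' : 0 < t := lt_of_le_of_ne ht.1 (Ne.symm ht0)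
        have htT : t + h ≤ T := by linarith [ht.2]
        have htT' : t < T := by linarith
        by_cases hE : t + h = T
        · exfalso
          linarith [ht.2, hh.trans_le (min_le_right _ _)]
        have e1 := ht1 ⟨ht0', htT'⟩
        have e2 := ht2 ⟨by linarith, lt_of_le_of_ne htT hE⟩
        -- The symmetric test element turns the left side into a difference of squares, so no
        -- product rule in the dual space is needed.
        have hw := hweak (v t + v (t + h)) t (t + h) ht0'.le (by linarith) htT
        rw [map_add, map_add, e1, e2] at hw
        have hl1 := hψl t ⟨ht0'.le, htT'.le⟩
        have hl2 := hψl (t + h) ⟨by linarith, htT⟩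
        have hl3 : l t ≤ l (t + h) := hlm (by linarith)
        have hnorm : ‖ψ t + ψ (t + h)‖ ≤ 2 * l (t + h) := (norm_add_le _ _).trans (by linarith)
        have hlhs : inner ℝ (ψ (t + h) - ψ t) (ψ t + ψ (t + h)) =
            ‖ψ (t + h)‖ ^ 2 - ‖ψ t‖ ^ 2 := by
          rw [inner_sub_left, inner_add_right, inner_add_right, real_inner_self_eq_norm_sq,
            real_inner_self_eq_norm_sq, real_inner_comm (ψ t)]
          ring
        rw [hlhs] at hw
        refine hw.trans ?_
        -- A bound for the integrand that is constant in `r`: `G r` is replaced by `G t` against `z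
        -- t` and by `G (t + h)` against `z (t + h)`, while monotonicity moves `k` and `l` to the
        -- right endpoint.
        set C := 2 * (k (t + h) * l (t + h)) - (p (t + h) + p t) + ε * (‖z t‖ + ‖z (t + h)‖)
        have hC : h * C = ∫ r in t..(t + h), C := by simp
        rw [hC]
        refine intervalIntegral.integral_mono_on (by linarith)
          (Continuous.intervalIntegrable (by fun_prop) _ _)
          intervalIntegrable_const fun r hr => ?_
        have hrI : r ∈ Icc 0 T := ⟨ht0'.le.trans hr.1, hr.2.trans htT⟩
        have g1 : ‖G t - G r‖ ≤ ε := hGδ t ⟨ht0'.le, htT'.le⟩ r hrI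
          (by rw [abs_of_nonpos (by linarith [hr.1])]; linarith [hr.2])
        have g2 : ‖G (t + h) - G r‖ ≤ ε := hGδ (t + h) ⟨by linarith, htT⟩ r hrI
          (by rw [abs_of_nonneg (by linarith [hr.2])]; linarith [hr.1])
        have i1 : inner ℝ (G t - G r) (z t) ≤ ε * ‖z t‖ :=
          (real_inner_le_norm _ _).trans (by gcongr)
        have i2 : inner ℝ (G (t + h) - G r) (z (t + h)) ≤ ε * ‖z (t + h)‖ :=
          (real_inner_le_norm _ _).trans (by gcongr)
        have i3 : k r * ‖ψ t + ψ (t + h)‖ ≤ k (t + h) * (2 * l (t + h)) :=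
          mul_le_mul (hkm hr.2) hnorm (norm_nonneg _) (hk0 _)
        rw [inner_sub_left] at i1 i2
        change -inner ℝ (G r) (z t + z (t + h)) + k r * ‖ψ t + ψ (t + h)‖ ≤
          2 * (k (t + h) * l (t + h)) - (inner ℝ (G (t + h)) (z (t + h)) + inner ℝ (G t) (z t)) +
            ε * (‖z t‖ + ‖z (t + h)‖)
        rw [inner_add_right]
        linarith
      have hshift : ∀ F : ℝ → ℝ, IntervalIntegrable F volume h (τ + h) →
          IntervalIntegrable (fun t => F (t + h)) volume 0 τ := fun F hF => by
        have := hF.comp_add_right h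
        simpa using this
      have I1 : IntervalIntegrable (fun t => ‖ψ (t + h)‖ ^ 2) volume 0 τ :=
        Continuous.intervalIntegrable (by fun_prop) _ _
      have I2 : IntervalIntegrable (fun t => ‖ψ t‖ ^ 2) volume 0 τ :=
        Continuous.intervalIntegrable (by fun_prop) _ _
      have I3 : IntervalIntegrable (fun t => 2 * (k (t + h) * l (t + h))) volume 0 τ :=
        Continuous.intervalIntegrable (by fun_prop) _ _
      have I4 : IntervalIntegrable (fun t => p (t + h)) volume 0 τ := hshift p (hGz _ _)
      have I5 : IntervalIntegrable p volume 0 τ := hGz _ _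
      have I6 : IntervalIntegrable (fun t => ‖z t‖) volume 0 τ := hzi.norm.intervalIntegrable
      have I7 : IntervalIntegrable (fun t => ‖z (t + h)‖) volume 0 τ :=
        hshift (fun t => ‖z t‖) hzi.norm.intervalIntegrable
      have hint := intervalIntegral.integral_mono_ae_restrict hτ (I1.sub I2)
        (((I3.sub (I4.add I5)).add ((I6.add I7).const_mul ε)).const_mul h) hpt
      rw [intervalIntegral.integral_sub I1 I2, intervalIntegral.integral_const_mul,
        intervalIntegral.integral_add (I3.sub (I4.add I5)) ((I6.add I7).const_mul ε),
        intervalIntegral.integral_sub I3 (I4.add I5), intervalIntegral.integral_add I4 I5,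
        intervalIntegral.integral_const_mul, intervalIntegral.integral_const_mul,
        intervalIntegral.integral_add I6 I7,
        intervalIntegral.integral_comp_add_right (fun t => ‖ψ t‖ ^ 2),
        intervalIntegral.integral_comp_add_right (fun t => k t * l t),
        intervalIntegral.integral_comp_add_right p,
        intervalIntegral.integral_comp_add_right (fun t => ‖z t‖), zero_add] at hint
      have s1 : ∫ r in h..(τ + h), ‖ψ r‖ ^ 2 = N (τ + h) - N h :=
        (intervalIntegral.integral_interval_sub_left (hnc.intervalIntegrable _ _)
          (hnc.intervalIntegrable _ _)).symm
      have s2 : ∫ r in h..(τ + h), p r = P (τ + h) - P h :=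
        (intervalIntegral.integral_interval_sub_left (hGz _ _) (hGz _ _)).symm
      have s3 : ∀ a b : ℝ, a ≤ b → ∫ r in a..b, ‖z r‖ ≤ Z := fun a b hab => by
        rw [intervalIntegral.integral_of_le hab]
        exact setIntegral_le_integral hzi.norm (ae_of_all _ fun _ => norm_nonneg _)
      rw [s1, s2] at hint
      have : ε * ((∫ r in (0 : ℝ)..τ, ‖z r‖) + ∫ r in h..(τ + h), ‖z r‖) ≤ ε * (2 * Z) := by
        have := s3 0 τ hτ
        have := s3 h (τ + h) (by linarith)
        gcongr
        linarith
      calc N (τ + h) - N τ - N h = N (τ + h) - N h - N τ := by ring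
        _ ≤ _ := hint
        _ ≤ _ := by gcongr
    have hmin : 0 < min δ (T - τ) := lt_min hδ (by linarith)
    have hev : ∀ᶠ h in 𝓝[>] (0 : ℝ), h ∈ Ioo 0 (min δ (T - τ)) := Ioo_mem_nhdsGT hmin
    have hder : ∀ t, HasDerivAt N (‖ψ t‖ ^ 2) t := fun t =>
      intervalIntegral.integral_hasDerivAt_right (hnc.intervalIntegrable _ _)
        (hnc.stronglyMeasurableAtFilter _ _) hnc.continuousAt
    have hN0 : N 0 = 0 := by simp [hN]
    have l1 := (hder τ).tendsto_slope_zero_right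
    have l2 := (hder 0).tendsto_slope_zero_right
    have hid : Tendsto (fun h : ℝ => h) (𝓝[>] 0) (𝓝 0) := tendsto_nhdsWithin_of_tendsto_nhds tendsto_id
    have hadd : Tendsto (fun h : ℝ => τ + h) (𝓝[>] 0) (𝓝 τ) := by
      simpa using hid.const_add τ
    have hP1 : Tendsto (fun h => P (τ + h)) (𝓝[>] 0) (𝓝 (P τ)) := by
      refine (hPc τ ⟨hτ, hτT.le⟩).tendsto.comp
        (tendsto_nhdsWithin_iff.2 ⟨hadd, ?_⟩)
      filter_upwards [hev] with h hh
      exact ⟨by linarith [hh.1], by linarith [hh.2.trans_le (min_le_right _ _)]⟩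
    have hP2 : Tendsto P (𝓝[>] 0) (𝓝 (P 0)) := by
      refine (hPc 0 ⟨le_rfl, hτ.trans hτT.le⟩).tendsto.comp
        (tendsto_nhdsWithin_iff.2 ⟨hid, ?_⟩)
      filter_upwards [hev] with h hh
      exact ⟨hh.1.le, by linarith [hh.2.trans_le (min_le_right _ _)]⟩
    have hP0 : P 0 = 0 := by simp [hP]
    have hKc : Continuous fun t => ∫ r in (0 : ℝ)..t, k r * l r :=
      intervalIntegral.continuous_primitive (fun _ _ => hkl.intervalIntegrable _ _) 0
    have hK : Tendsto (fun h => ∫ r in h..(τ + h), k r * l r) (𝓝[>] 0)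
        (𝓝 (∫ r in (0 : ℝ)..τ, k r * l r)) := by
      have := ((hKc.tendsto τ).comp hadd).sub ((hKc.tendsto 0).comp hid)
      simp only [intervalIntegral.integral_same, sub_zero] at this
      refine this.congr fun h => ?_
      exact intervalIntegral.integral_interval_sub_left (hkl.intervalIntegrable _ _)
          (hkl.intervalIntegrable _ _)
    -- After division by `h`, the left side tends to `‖ψ τ‖² - ‖ψ 0‖²`, being a difference of two
    -- slopes of `N`, and the bracket in `P` tends to `2 P τ`. The error `2 ε Z` is removed
    -- afterwards.
    have hlim := le_of_tendsto_of_tendsto (l1.sub l2)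
      (((hK.const_mul 2).sub ((hP1.sub hP2).add_const (P τ))).add_const (ε * (2 * Z))) (by
        filter_upwards [hev] with h hh
        have h0 : 0 < h := hh.1
        have := hstep h hh
        simp only [smul_eq_mul, zero_add, hN0, sub_zero]
        rw [← mul_sub, inv_mul_le_iff₀ h0]
        exact this)
    rw [hP0] at hlim
    linarith
  have hlim : Tendsto (fun ε : ℝ => ‖ψ 0‖ ^ 2 + 2 * (∫ r in (0 : ℝ)..τ, k r * l r)
      - 2 * P τ + ε * (2 * Z)) (𝓝[>] 0) (𝓝 (‖ψ 0‖ ^ 2 + 2 * (∫ r in (0 : ℝ)..τ, k r * l r)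
      - 2 * P τ + 0 * (2 * Z))) :=
    ((tendsto_id.mul_const _).const_add _).mono_left nhdsWithin_le_nhds
  rw [zero_mul, add_zero] at hlim
  exact ge_of_tendsto hlim (eventually_nhdsWithin_of_forall key)

theorem integral_mul_exp_le {a c : ℝ} (ha : 0 ≤ a) (hc : 0 < c) (τ : ℝ) :
    ∫ r in (0 : ℝ)..τ, a * Real.exp (c * r) ≤ a / c * Real.exp (c * τ) := by
  rw [intervalIntegral.integral_const_mul,
    intervalIntegral.integral_comp_mul_left (fun x => Real.exp x) hc.ne', integral_exp, mul_zero,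
    Real.exp_zero, smul_eq_mul, div_eq_mul_inv, mul_assoc]
  gcongr
  linarith

/-- Uniqueness for an abstract second order evolution equation: the velocity `ψ` vanishes if the
lower order term is controlled by any monotone majorant of `‖ψ‖`. -/
theorem eq_zero_of_weak_equation {H L K : Type*}
    [NormedAddCommGroup H] [NormedSpace ℝ H] [CompleteSpace H]
    [NormedAddCommGroup L] [InnerProductSpace ℝ L]
    [NormedAddCommGroup K] [InnerProductSpace ℝ K] [CompleteSpace K]
    (j : H →L[ℝ] L) (D : H →L[ℝ] K) {T : ℝ} {v : ℝ → H} (hv : Integrable v)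
    {ψ : ℝ → L} (hψ : Continuous ψ) (hψ0 : ψ 0 = 0)
    (hjv : ∀ᵐ t, t ∈ Ioo 0 T → j (v t) = ψ t)
    {A : ℝ → K →L[ℝ] K} {M b : ℝ} (hM : 0 ≤ M) (hb : 0 < b)
    (hA : ∀ s t, ‖A t - A s‖ ≤ M * |t - s|)
    (hsymm : ∀ t x y, inner ℝ (A t x) y = inner ℝ x (A t y))
    (hcoer : ∀ t x, b * ‖x‖ ^ 2 ≤ inner ℝ (A t x) x)
    {c : ℝ} (hc : 0 ≤ c)
    (hweak : ∀ q : ℝ → ℝ, Continuous q → Monotone q → (∀ t, 0 ≤ q t) →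
      (∀ t ∈ Icc 0 T, ‖ψ t‖ ≤ q t) → ∀ χ, ∀ s t, 0 ≤ s → s ≤ t → t ≤ T →
      inner ℝ (ψ t - ψ s) (j χ) ≤
        ∫ r in s..t, (-inner ℝ (A r (D (∫ x in (0 : ℝ)..r, v x))) (D χ) + c * q r * ‖j χ‖)) :
    ∀ t ∈ Icc 0 T, ψ t = 0 := by
  intro t₀ ht₀
  have hT : 0 ≤ T := ht₀.1.trans ht₀.2
  rcases hT.eq_or_lt with rfl | hT'
  · rw [le_antisymm ht₀.2 ht₀.1, hψ0]
  set y : ℝ → K := fun r => D (∫ x in (0 : ℝ)..r, v x) with hy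
  have hyi : ∀ t, y t = ∫ r in (0 : ℝ)..t, D (v r) := fun t =>
    (D.intervalIntegral_comp_comm hv.intervalIntegrable).symm
  have hyc : Continuous y := by
    have := intervalIntegral.continuous_primitive (fun _ _ => hv.intervalIntegrable) 0
    exact D.continuous.comp this
  have hG : Continuous fun r => A r (y r) := (continuous_of_norm_sub_le hA).clm_apply hyc
  set e : ℝ → ℝ := fun t => ‖ψ t‖ ^ 2 + b * ‖y t‖ ^ 2 with he
  have hec : Continuous e := by fun_prop
  set C := 2 * c + M / b with hC
  have hC0 : 0 ≤ C := by positivity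
  -- The weight is chosen so that `C / m ≤ 1 / 2`.
  set m := 2 * C + 1 with hm
  have hm0 : 0 < m := by positivity
  obtain ⟨t₁, ht₁, hmax⟩ := isCompact_Icc.exists_isMaxOn (nonempty_Icc.2 hT)
    (f := fun t => e t * Real.exp (-(m * t))) (by fun_prop)
  set a := e t₁ * Real.exp (-(m * t₁)) with ha
  have ha0 : 0 ≤ a := by positivity
  have hea : ∀ t ∈ Icc 0 T, e t ≤ a * Real.exp (m * t) := fun t ht => by
    have : e t * Real.exp (-(m * t)) ≤ a := hmax ht
    rwa [Real.exp_neg, ← div_eq_mul_inv, div_le_iff₀ (Real.exp_pos _)] at this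
  -- By maximality of `a`, the energy is at most `q²`; hence `q` is an admissible majorant of `‖ψ‖`,
  -- monotone although `‖ψ‖` need not be.
  set q : ℝ → ℝ := fun t => Real.sqrt (a * Real.exp (m * t)) with hq
  have hqc : Continuous q := by fun_prop
  have hqm : Monotone q := fun s t hst => by
    simp only [hq]
    gcongr
  have hq0 : ∀ t, 0 ≤ q t := fun t => Real.sqrt_nonneg _
  have hqq : ∀ t, q t * q t = a * Real.exp (m * t) := fun t =>
    Real.mul_self_sqrt (by positivity)
  have hψq : ∀ t ∈ Icc 0 T, ‖ψ t‖ ≤ q t := fun t ht => by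
    refine Real.le_sqrt_of_sq_le ((le_add_of_nonneg_right ?_).trans (hea t ht))
    positivity
  -- The endpoint `T` is left out because the energy inequality needs room for the shift `h`;
  -- closedness of the inequality restores it below.
  have hstep : ∀ τ ∈ Ico 0 T, e τ * Real.exp (-(m * τ)) ≤ a / 2 := by
    rintro τ ⟨hτ, hτT⟩
    have h1 := norm_sq_le_of_weak_equation j D hv hψ hjv hG (hqc.const_mul c) hqc
      (fun s t hst => mul_le_mul_of_nonneg_left (hqm hst) hc) hqm
      (fun t => mul_nonneg hc (hq0 t)) hψq (hweak q hqc hqm hq0 hψq) hτ hτT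
    have h2 := inner_apply_self_le_of_lipschitz hM hA hsymm (D.integrable_comp hv) hyi hτ
    have h3 := hcoer τ (y τ)
    have hexp : Continuous fun r => a * Real.exp (m * r) := by fun_prop
    have h4 : ∫ r in (0 : ℝ)..τ, c * q r * q r = c * ∫ r in (0 : ℝ)..τ, a * Real.exp (m * r) := by
      rw [← intervalIntegral.integral_const_mul]
      exact intervalIntegral.integral_congr fun r _ => by simp only [mul_assoc, hqq]
    have h5 : ∫ r in (0 : ℝ)..τ, ‖y r‖ ^ 2 ≤ ∫ r in (0 : ℝ)..τ, b⁻¹ * (a * Real.exp (m * r)) := by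
      refine intervalIntegral.integral_mono_on hτ (Continuous.intervalIntegrable (by fun_prop) _ _)
        (Continuous.intervalIntegrable (by fun_prop) _ _) fun r hr => ?_
      rw [le_inv_mul_iff₀ hb]
      exact (le_add_of_nonneg_left (by positivity)).trans (hea r ⟨hr.1, hr.2.trans hτT.le⟩)
    rw [intervalIntegral.integral_const_mul] at h5
    rw [h4, hψ0, norm_zero] at h1
    have h6 := integral_mul_exp_le ha0 hm0 τ
    have h7 : e τ ≤ C * (a / m * Real.exp (m * τ)) := by
      calc e τ ≤ 2 * (c * ∫ r in (0 : ℝ)..τ, a * Real.exp (m * r)) +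
            M * (b⁻¹ * ∫ r in (0 : ℝ)..τ, a * Real.exp (m * r)) := by
            have := mul_le_mul_of_nonneg_left h5 hM
            simp only [he]
            linarith
        _ = C * ∫ r in (0 : ℝ)..τ, a * Real.exp (m * r) := by rw [hC]; ring
        _ ≤ _ := by gcongr
    have h8 : C * (a / m) ≤ a / 2 := by
      rw [mul_div_assoc', div_le_div_iff₀ hm0 two_pos, hm]
      nlinarith
    rw [Real.exp_neg, ← div_eq_mul_inv, div_le_iff₀ (Real.exp_pos _)]
    refine h7.trans ?_
    rw [← mul_assoc]
    gcongr
  have hclosed : IsClosed {τ | e τ * Real.exp (-(m * τ)) ≤ a / 2} :=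
    isClosed_le (by fun_prop) continuous_const
  have hstep' : Icc 0 T ⊆ {τ | e τ * Real.exp (-(m * τ)) ≤ a / 2} := by
    rw [← closure_Ico hT'.ne]
    exact hclosed.closure_subset_iff.2 hstep
  have ha2 : a ≤ a / 2 := hstep' ht₁
  have hazero : a = 0 := by linarith
  have h9 := hea t₀ ht₀
  rw [hazero, zero_mul] at h9
  have h10 : ‖ψ t₀‖ ^ 2 ≤ 0 := (le_add_of_nonneg_right (by positivity)).trans h9
  exact norm_eq_zero.1 (pow_eq_zero_iff two_ne_zero |>.1 (le_antisymm h10 (by positivity)))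

/-! ### Test functions and the du Bois-Reymond lemma. -/

namespace IsTestFunction

theorem integrable_smul {E X : Type*} [NormedAddCommGroup E] [NormedSpace ℝ E]
    [MeasurableSpace E] [OpensMeasurableSpace E]
    [NormedAddCommGroup X] [NormedSpace ℝ X] {A : Set E} {φ : E → ℝ} {ν : Measure E}
    (hφ : IsTestFunction A φ) {u : E → X} (hu : Integrable u ν) :
    Integrable (fun t => φ t • u t) ν := by
  obtain ⟨C, hC⟩ := hφ.1.continuous.bounded_above_of_compact_support hφ.2.1
  refine hu.bdd_smul C ?_ (ae_of_all _ hC)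
  exact hφ.1.continuous.measurable.aestronglyMeasurable

theorem deriv {A : Set ℝ} {φ : ℝ → ℝ} (hφ : IsTestFunction A φ) : IsTestFunction A (deriv φ) := by
  refine ⟨?_, hφ.2.1.deriv, (tsupport_deriv_subset).trans hφ.2.2⟩
  exact (contDiff_infty_iff_deriv.1 hφ.1).2

theorem setIntegral_smul_eq {E X : Type*} [NormedAddCommGroup E] [NormedSpace ℝ E]
    [MeasurableSpace E] {ν : Measure E}
    [NormedAddCommGroup X] [NormedSpace ℝ X] {A : Set E} {φ : E → ℝ}
    (hφ : IsTestFunction A φ) (u : E → X) :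
    ∫ t in A, φ t • u t ∂ν = ∫ t, φ t • u t ∂ν := by
  refine setIntegral_eq_integral_of_forall_compl_eq_zero fun t ht => ?_
  rw [image_eq_zero_of_notMem_tsupport fun h => ht (hφ.2.2 h), zero_smul]

theorem sub_const_mul {E : Type*} [NormedAddCommGroup E] [NormedSpace ℝ E] {A : Set E}
    {φ η : E → ℝ} (hφ : IsTestFunction A φ) (hη : IsTestFunction A η) (c : ℝ) :
    IsTestFunction A (fun t => φ t - c * η t) := by
  refine ⟨hφ.1.sub (contDiff_const.mul hη.1), hφ.2.1.sub (hη.2.1.mul_left), ?_⟩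
  refine (tsupport_sub _ _).trans (union_subset hφ.2.2 ?_)
  exact (tsupport_mul_subset_right (f := fun _ => c)).trans hη.2.2

end IsTestFunction

theorem exists_isTestFunction_integral_eq_one {T : ℝ} (hT : 0 < T) :
    ∃ η : ℝ → ℝ, IsTestFunction (Ioo 0 T) η ∧ ∫ t, η t = 1 := by
  let f : ContDiffBump (T / 2) := ⟨T / 8, T / 4, by positivity, by linarith⟩
  refine ⟨f.normed volume, ⟨f.contDiff_normed, f.hasCompactSupport_normed, ?_⟩,
    f.integral_normed⟩
  rw [f.tsupport_normed_eq, Real.closedBall_eq_Icc]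
  exact Icc_subset_Ioo (by simp only [f]; linarith) (by simp only [f]; linarith)

theorem IsCompact.exists_subset_Icc_of_subset_Ioo {K : Set ℝ} {T : ℝ} (hT : 0 < T)
    (hK : IsCompact K) (h : K ⊆ Ioo 0 T) : ∃ a b, 0 < a ∧ b < T ∧ K ⊆ Icc a b := by
  -- The extra point ensures that the set is nonempty, so that it has a least and a greatest
  -- element.
  have hK' : IsCompact (insert (T / 2) K) := hK.insert _
  obtain ⟨a, ha, ha'⟩ := hK'.exists_isLeast (insert_nonempty _ _)
  obtain ⟨b, hb, hb'⟩ := hK'.exists_isGreatest (insert_nonempty _ _)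
  have hsub : insert (T / 2) K ⊆ Ioo 0 T :=
    insert_subset ⟨by linarith, by linarith⟩ h
  exact ⟨a, b, (hsub ha).1, (hsub hb).2, fun x hx =>
    ⟨ha' (mem_insert_of_mem _ hx), hb' (mem_insert_of_mem _ hx)⟩⟩

/-- To the right of the support of `η` the primitive equals the full integral, so zero mean is what
makes its support compact in `(0, T)`. -/
theorem IsTestFunction.primitive {T : ℝ} (hT : 0 < T) {η : ℝ → ℝ} (hη : IsTestFunction (Ioo 0 T) η)
    (h0 : ∫ t, η t = 0) : IsTestFunction (Ioo 0 T) (fun t => ∫ r in (0 : ℝ)..t, η r) := by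
  have hd : ∀ t, HasDerivAt (fun t => ∫ r in (0 : ℝ)..t, η r) (η t) t := fun t =>
    intervalIntegral.integral_hasDerivAt_right (hη.1.continuous.intervalIntegrable _ _)
      (hη.1.continuous.stronglyMeasurableAtFilter _ _) hη.1.continuous.continuousAt
  obtain ⟨a, b, ha, hb, hab⟩ := IsCompact.exists_subset_Icc_of_subset_Ioo hT hη.2.1 hη.2.2
  have hz : ∀ t, t ∉ Icc a b → η t = 0 := fun t ht =>
    image_eq_zero_of_notMem_tsupport fun h => ht (hab h)
  have hsupp : Function.support (fun t => ∫ r in (0 : ℝ)..t, η r) ⊆ Icc a b := by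
    intro t ht
    by_contra hcon
    apply ht
    rcases lt_or_ge t a with hta | hta
    · refine intervalIntegral.integral_zero_ae (ae_of_all _ fun r hr => hz r fun hr' => ?_)
      rcases le_total 0 t with h | h
      · rw [uIoc_of_le h] at hr
        linarith [hr.2, hr'.1]
      · rw [uIoc_of_ge h] at hr
        linarith [hr.2, hr'.1]
    · have htb : b < t := by
        by_contra hh
        exact hcon ⟨hta, not_lt.1 hh⟩
      change ∫ r in (0 : ℝ)..t, η r = 0
      rw [intervalIntegral.integral_of_le (ha.le.trans hta)]
      refine (?_ : _ = ∫ t, η t).trans h0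
      refine setIntegral_eq_integral_of_forall_compl_eq_zero fun r hr => hz r fun hr' => hr ?_
      exact ⟨ha.trans_le hr'.1, hr'.2.trans htb.le⟩
  have hts : tsupport (fun t => ∫ r in (0 : ℝ)..t, η r) ⊆ Icc a b :=
    closure_minimal hsupp isClosed_Icc
  refine ⟨contDiff_infty_iff_deriv.2 ⟨fun t => (hd t).differentiableAt, ?_⟩,
    isCompact_Icc.of_isClosed_subset (isClosed_tsupport _) hts,
    hts.trans (Icc_subset_Ioo ha hb)⟩
  rw [funext fun t => (hd t).deriv]
  exact hη.1

section

variable {X : Type*} [NormedAddCommGroup X] [NormedSpace ℝ X]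

/-- Integration by parts of a test function against the primitive of an integrable function. -/
theorem IsTestFunction.integral_deriv_smul_primitive [CompleteSpace X] {T : ℝ} {θ : ℝ → ℝ}
    (hθ : IsTestFunction (Ioo 0 T) θ) {v : ℝ → X} (hv : IntegrableOn v (Ioo 0 T)) :
    ∫ t in Ioo 0 T, _root_.deriv θ t • (∫ r in (0 : ℝ)..t, v r) = -∫ t in Ioo 0 T, θ t • v t := by
  set ν := volume.restrict (Ioo (0 : ℝ) T) with hν
  have hθ' := hθ.deriv
  have hθi : Integrable (_root_.deriv θ) ν :=
    (hθ'.1.continuous.integrable_of_hasCompactSupport hθ'.2.1).integrableOn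
  -- Fubini on the triangle `r ≤ t`: integrating first in `t` gives `θ T - θ r = -θ r`.
  have hprod : Integrable (fun p : ℝ × ℝ => _root_.deriv θ p.1 • v p.2) (ν.prod ν) :=
    hθi.smul_prod hv
  have hm : MeasurableSet {p : ℝ × ℝ | p.2 ≤ p.1} := measurableSet_le measurable_snd measurable_fst
  have hF := hprod.indicator hm
  have e1 : ∀ t ∈ Ioo 0 T, _root_.deriv θ t • (∫ r in (0 : ℝ)..t, v r) =
      ∫ r, {p : ℝ × ℝ | p.2 ≤ p.1}.indicator
        (fun p : ℝ × ℝ => _root_.deriv θ p.1 • v p.2) (t, r) ∂ν := by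
    intro t ht
    have : ∀ r, {p : ℝ × ℝ | p.2 ≤ p.1}.indicator
        (fun p : ℝ × ℝ => _root_.deriv θ p.1 • v p.2) (t, r) =
        _root_.deriv θ t • (Iic t).indicator v r := fun r => by
      by_cases h : r ≤ t <;> simp [indicator, h]
    simp_rw [this]
    rw [integral_smul, integral_indicator measurableSet_Iic, hν,
      Measure.restrict_restrict measurableSet_Iic,
      intervalIntegral.integral_of_le ht.1.le]
    congr 3
    ext r
    simp only [mem_Ioc, mem_inter_iff, mem_Iic, mem_Ioo]
    exact ⟨fun h => ⟨h.2, h.1, h.2.trans_lt ht.2⟩, fun h => ⟨h.2.1, h.1⟩⟩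
  have e2 : ∀ r ∈ Ioo 0 T, ∫ t, {p : ℝ × ℝ | p.2 ≤ p.1}.indicator
        (fun p : ℝ × ℝ => _root_.deriv θ p.1 • v p.2) (t, r) ∂ν = -(θ r • v r) := by
    intro r hr
    have : ∀ t, {p : ℝ × ℝ | p.2 ≤ p.1}.indicator
        (fun p : ℝ × ℝ => _root_.deriv θ p.1 • v p.2) (t, r) =
        (Ici r).indicator (_root_.deriv θ) t • v r := fun t => by
      by_cases h : r ≤ t <;> simp [indicator, h]
    simp_rw [this]
    rw [integral_smul_const, integral_indicator measurableSet_Ici, hν,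
      Measure.restrict_restrict measurableSet_Ici]
    have hset : Ici r ∩ Ioo 0 T = Ico r T := by
      ext t
      simp only [mem_inter_iff, mem_Ici, mem_Ioo, mem_Ico]
      exact ⟨fun h => ⟨h.1, h.2.2⟩, fun h => ⟨h.1, hr.1.trans_le h.1, h.2⟩⟩
    rw [hset, integral_Ico_eq_integral_Ioc, ← intervalIntegral.integral_of_le hr.2.le,
      intervalIntegral.integral_deriv_eq_sub
        (fun t _ => (hθ.1.differentiable (by simp)).differentiableAt)
        (hθ'.1.continuous.intervalIntegrable _ _)]
    have : θ T = 0 := image_eq_zero_of_notMem_tsupport fun h => (hθ.2.2 h).2.false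
    rw [this, zero_sub, neg_smul]
  rw [setIntegral_congr_fun measurableSet_Ioo e1, integral_integral_swap (f := fun t r =>
      {p : ℝ × ℝ | p.2 ≤ p.1}.indicator (fun p : ℝ × ℝ => _root_.deriv θ p.1 • v p.2) (t, r)) hF,
    setIntegral_congr_fun measurableSet_Ioo e2, integral_neg]

/-- The **du Bois-Reymond lemma**: a function with an integrable weak derivative is, up to a
constant, a primitive of it. -/
theorem ae_eq_add_primitive_of_weakDeriv [CompleteSpace X] {T : ℝ} (hT : 0 < T) {u v : ℝ → X}
    (hu : IntegrableOn u (Ioo 0 T)) (hv : IntegrableOn v (Ioo 0 T))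
    (h : ∀ φ : ℝ → ℝ, IsTestFunction (Ioo 0 T) φ →
      ∫ t in Ioo 0 T, deriv φ t • u t = -∫ t in Ioo 0 T, φ t • v t)
    {η₀ : ℝ → ℝ} (hη₀ : IsTestFunction (Ioo 0 T) η₀) (hη₀1 : ∫ t, η₀ t = 1) :
    ∀ᵐ t, t ∈ Ioo 0 T → u t = (∫ r in Ioo 0 T, η₀ r • (u r - ∫ s in (0 : ℝ)..r, v s)) +
      ∫ s in (0 : ℝ)..t, v s := by
  set V : ℝ → X := fun t => ∫ s in (0 : ℝ)..t, v s with hV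
  set c := ∫ r in Ioo 0 T, η₀ r • (u r - V r) with hc
  have hVi : IntegrableOn V (Ioo 0 T) := by
    have : ContinuousOn V (uIcc 0 T) := intervalIntegral.continuousOn_primitive_interval (by
      rw [uIcc_of_le hT.le]
      exact (integrableOn_Icc_iff_integrableOn_Ioo (by simp) (by simp)).2 hv)
    rw [uIcc_of_le hT.le] at this
    exact (this.integrableOn_compact isCompact_Icc).mono_set Ioo_subset_Icc_self
  have hci : IntegrableOn (fun _ : ℝ => c) (Ioo 0 T) := integrableOn_const (by simp)
  have hg : IntegrableOn (fun t => u t - V t) (Ioo 0 T) := hu.sub hVi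
  have key : ∀ᵐ t, t ∈ Ioo 0 T → u t - V t - c = 0 := by
    refine isOpen_Ioo.ae_eq_zero_of_integral_contDiff_smul_eq_zero
      (hg.sub hci).locallyIntegrableOn fun η h1 h2 h3 => ?_
    have hη : IsTestFunction (Ioo 0 T) η := ⟨h1, h2, h3⟩
    -- Subtracting `I η₀` makes the mean zero, so the result is the derivative of a test function,
    -- and the hypothesis applies to it. The subtracted part produces the constant `c`.
    set I := ∫ t, η t with hI
    have hζ := hη.sub_const_mul hη₀ I
    have hηi := hη.1.continuous.integrable_of_hasCompactSupport hη.2.1 (μ := volume)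
    have hη₀i := hη₀.1.continuous.integrable_of_hasCompactSupport hη₀.2.1 (μ := volume)
    have hζ0 : ∫ t, (η t - I * η₀ t) = 0 := by
      rw [integral_sub hηi (hη₀i.const_mul I), integral_const_mul, hη₀1, mul_one, sub_self]
    have hθ := hζ.primitive hT hζ0
    have hd : deriv (fun t => ∫ r in (0 : ℝ)..t, (η r - I * η₀ r)) = fun t => η t - I * η₀ t :=
      funext fun t => (intervalIntegral.integral_hasDerivAt_right
        (hζ.1.continuous.intervalIntegrable _ _)
        (hζ.1.continuous.stronglyMeasurableAtFilter _ _) hζ.1.continuous.continuousAt).deriv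
    have a1 := h _ hθ
    have a2 := hθ.integral_deriv_smul_primitive hv
    rw [hd] at a1 a2
    have a3 : ∫ t in Ioo 0 T, (η t - I * η₀ t) • (u t - V t) = 0 := by
      simp_rw [smul_sub]
      rw [integral_sub (hζ.integrable_smul hu) (hζ.integrable_smul hVi), a1, a2, sub_self]
    simp_rw [sub_smul, mul_smul] at a3
    rw [integral_sub (hη.integrable_smul hg) (g := fun t => I • η₀ t • (u t - V t))
      ((hη₀.integrable_smul hg).smul I), integral_smul,
      ← hc] at a3
    rw [← hη.setIntegral_smul_eq (fun t => u t - V t - c)]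
    simp_rw [smul_sub _ _ c]
    rw [integral_sub (hη.integrable_smul hg) (hη.integrable_smul hci),
      hη.setIntegral_smul_eq (fun _ => c), integral_smul_const]
    exact a3
  filter_upwards [key] with t ht htI
  rw [← sub_eq_zero, ← ht htI]
  abel

/-- A continuous function with an integrable weak derivative is a primitive of it. -/
theorem HasWeakTimeDeriv.sub_eq_integral [CompleteSpace X] {T : ℝ} (hT : 0 < T) {u v : ℝ → X}
    (h : HasWeakTimeDeriv T u v) (hu : ContinuousOn u (Icc 0 T)) (hv : IntegrableOn v (Ioo 0 T)) :
    ∀ t ∈ Icc 0 T, u t - u 0 = ∫ s in (0 : ℝ)..t, v s := by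
  obtain ⟨η₀, hη₀, hη₀1⟩ := exists_isTestFunction_integral_eq_one hT
  have hui : IntegrableOn u (Ioo 0 T) :=
    (hu.integrableOn_compact isCompact_Icc).mono_set Ioo_subset_Icc_self
  have hae := ae_eq_add_primitive_of_weakDeriv hT hui hv h.2.2 hη₀ hη₀1
  set c := ∫ r in Ioo 0 T, η₀ r • (u r - ∫ s in (0 : ℝ)..r, v s)
  have hVc : ContinuousOn (fun t => ∫ s in (0 : ℝ)..t, v s) (Icc 0 T) := by
    rw [← uIcc_of_le hT.le]
    refine intervalIntegral.continuousOn_primitive_interval ?_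
    rw [uIcc_of_le hT.le]
    exact (integrableOn_Icc_iff_integrableOn_Ioo (by simp) (by simp)).2 hv
  have heq : EqOn u (fun t => c + ∫ s in (0 : ℝ)..t, v s) (Icc 0 T) := by
    refine Measure.eqOn_Icc_of_ae_eq volume hT.ne ?_ hu (hVc.const_add c)
    rw [Filter.EventuallyEq, ae_restrict_iff' measurableSet_Icc]
    filter_upwards [hae, compl_mem_ae_iff.2 (measure_singleton (0 : ℝ)),
      compl_mem_ae_iff.2 (measure_singleton T)] with t ht h0 hT' hI
    exact ht ⟨lt_of_le_of_ne hI.1 (Ne.symm h0), lt_of_le_of_ne hI.2 hT'⟩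
  intro t ht
  rw [heq ht, heq ⟨le_rfl, hT.le⟩]
  simp

end

/-! ### The gradient on `H¹₀(Θ)` and injectivity into `L²(Θ)`. -/

theorem integral_mul_fderiv_add_inner_gradient_eq_zero {d : ℕ} {Θ : Set (EuclideanSpace ℝ (Fin d))}
    {φ η : EuclideanSpace ℝ (Fin d) → ℝ} (hφ : IsTestFunction Θ φ) (hη : IsTestFunction Θ η)
    (e : EuclideanSpace ℝ (Fin d)) :
    (∫ x in Θ, fderiv ℝ η x e * φ x) + ∫ x in Θ, inner ℝ (η x • e) (gradient φ x) = 0 := by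
  have hφd : Differentiable ℝ φ := hφ.1.differentiable (by simp)
  have hηd : Differentiable ℝ η := hη.1.differentiable (by simp)
  have hφ' : Continuous fun x => fderiv ℝ φ x e :=
    (hφ.1.continuous_fderiv (by simp)).clm_apply continuous_const
  have hη' : Continuous fun x => fderiv ℝ η x e :=
    (hη.1.continuous_fderiv (by simp)).clm_apply continuous_const
  have h := integral_mul_fderiv_eq_neg_fderiv_mul_of_integrable (μ := volume) (f := η) (g := φ)
    (v := e)
    ((hη'.mul hφ.1.continuous).integrable_of_hasCompactSupport hφ.2.1.mul_left)
    ((hη.1.continuous.mul hφ').integrable_of_hasCompactSupport hη.2.1.mul_right)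
    ((hη.1.continuous.mul hφ.1.continuous).integrable_of_hasCompactSupport hφ.2.1.mul_left)
    (fun x _ => hηd x) (fun x _ => hφd x)
  have e1 : ∀ x, inner ℝ (η x • e) (gradient φ x) = η x * fderiv ℝ φ x e := fun x => by
    rw [inner_smul_left, real_inner_comm, gradient, InnerProductSpace.toDual_symm_apply]
    simp
  simp_rw [e1]
  rw [setIntegral_eq_integral_of_forall_compl_eq_zero, setIntegral_eq_integral_of_forall_compl_eq_zero, h,
    add_neg_cancel]
  · intro x hx
    rw [image_eq_zero_of_notMem_tsupport fun hx' => hx (hη.2.2 hx'), zero_mul]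
  · intro x hx
    rw [image_eq_zero_of_notMem_tsupport fun hx' => hx (hφ.2.2 hx'), mul_zero]

/-- The weak gradient of an element of `H¹₀(Θ)` is its distributional gradient. -/
theorem H10.integral_fderiv_mul_add_integral_inner_grad {d : ℕ}
    {Θ : Set (EuclideanSpace ℝ (Fin d))} (χ : H10 Θ) {η : EuclideanSpace ℝ (Fin d) → ℝ}
    (hη : IsTestFunction Θ η) (e : EuclideanSpace ℝ (Fin d)) :
    (∫ x in Θ, fderiv ℝ η x e * H10.toL2 Θ χ x) +
      ∫ x in Θ, inner ℝ (η x • e) (H10.grad Θ χ x) = 0 := by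
  have hη' : Continuous fun x => fderiv ℝ η x e :=
    (hη.1.continuous_fderiv (by simp)).clm_apply continuous_const
  have hm1 : MemLp (fun x => fderiv ℝ η x e) 2 (volume.restrict Θ) :=
    (hη'.memLp_of_hasCompactSupport (hη.2.1.fderiv_apply ℝ e)).restrict Θ
  have hm2 : MemLp (fun x => η x • e) 2 (volume.restrict Θ) :=
    ((hη.1.continuous.smul continuous_const).memLp_of_hasCompactSupport
      hη.2.1.smul_right).restrict Θ
  -- For fixed `η` and `e` the identity says that a continuous functional vanishes; it passes from
  -- test pairs to their closed span.
  set F : WithLp 2 (L2 Θ × L2Vec Θ) →L[ℝ] ℝ :=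
    (innerSL ℝ (hm1.toLp _)).comp (WithLp.fstL 2 ℝ (L2 Θ) (L2Vec Θ)) +
    (innerSL ℝ (hm2.toLp _)).comp (WithLp.sndL 2 ℝ (L2 Θ) (L2Vec Θ)) with hF
  have hFapply : ∀ w, F w = (∫ x in Θ, fderiv ℝ η x e * w.fst x) +
      ∫ x in Θ, inner ℝ (η x • e) (w.snd x) := by
    intro w
    have : F w = inner ℝ (hm1.toLp _) w.fst + inner ℝ (hm2.toLp _) w.snd := rfl
    rw [this, L2.inner_def, L2.inner_def]
    congr 1
    · refine integral_congr_ae ?_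
      filter_upwards [hm1.coeFn_toLp] with x hx
      rw [hx]
      simp [mul_comm]
    · refine integral_congr_ae ?_
      filter_upwards [hm2.coeFn_toLp] with x hx
      rw [hx]
  have hle : H10Submodule Θ ≤ LinearMap.ker (F : WithLp 2 (L2 Θ × L2Vec Θ) →ₗ[ℝ] ℝ) := by
    refine Submodule.topologicalClosure_minimal _ (Submodule.span_le.2 ?_) F.isClosed_ker
    rintro w ⟨φ, hφ, h1, h2⟩
    change F w = 0
    rw [hFapply, ← integral_mul_fderiv_add_inner_gradient_eq_zero hφ hη e]
    congr 1
    · refine integral_congr_ae ?_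
      filter_upwards [h1] with x hx
      rw [hx]
    · refine integral_congr_ae ?_
      filter_upwards [h2] with x hx
      rw [hx]
  have := hle χ.2
  exact (hFapply χ.1).symm.trans this

/-- Closability of the gradient: the second component is the distributional gradient of the first,
so a pair `(0, g)` in the closure has `g = 0`. -/
theorem H10.grad_eq_zero_of_toL2_eq_zero {d : ℕ} {Θ : Set (EuclideanSpace ℝ (Fin d))}
    (hΘ : IsOpen Θ) {χ : H10 Θ} (h : H10.toL2 Θ χ = 0) : H10.grad Θ χ = 0 := by
  have key : ∀ e : EuclideanSpace ℝ (Fin d), ∀ᵐ x ∂volume.restrict Θ,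
      inner ℝ e (H10.grad Θ χ x) = 0 := by
    intro e
    have hl : LocallyIntegrableOn (fun x => inner ℝ e (H10.grad Θ χ x)) Θ :=
      locallyIntegrableOn_of_locallyIntegrable_restrict
        (((innerSL ℝ e).comp_memLp' (Lp.memLp (H10.grad Θ χ))).locallyIntegrable (by norm_num))
    rw [ae_restrict_iff' hΘ.measurableSet]
    refine hΘ.ae_eq_zero_of_integral_contDiff_smul_eq_zero hl fun η h1 h2 h3 => ?_
    have hη : IsTestFunction Θ η := ⟨h1, h2, h3⟩
    have := H10.integral_fderiv_mul_add_integral_inner_grad χ hη e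
    rw [← hη.setIntegral_smul_eq]
    have h0 : ∫ x in Θ, fderiv ℝ η x e * H10.toL2 Θ χ x = 0 := by
      rw [h]
      refine integral_eq_zero_of_ae ?_
      filter_upwards [Lp.coeFn_zero ℝ 2 (volume.restrict Θ)] with x hx
      rw [hx]
      simp
    rw [h0, zero_add] at this
    simpa [inner_smul_left] using this
  have hall : ∀ᵐ x ∂volume.restrict Θ, ∀ i : Fin d,
      inner ℝ (EuclideanSpace.single i (1 : ℝ)) (H10.grad Θ χ x) = 0 :=
    ae_all_iff.2 fun i => key _
  refine Lp.ext ?_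
  filter_upwards [hall, Lp.coeFn_zero (EuclideanSpace ℝ (Fin d)) 2 (volume.restrict Θ)]
    with x hx h0
  rw [h0]
  ext i
  simpa [EuclideanSpace.inner_single_left] using hx i

/-- Allows equalities in `H¹₀` to be checked in `L²`, although elements of `H¹₀` are pairs. -/
theorem H10.toL2_injective {d : ℕ} {Θ : Set (EuclideanSpace ℝ (Fin d))} (hΘ : IsOpen Θ) :
    Function.Injective (H10.toL2 Θ) := by
  refine (injective_iff_map_eq_zero _).2 fun χ h => ?_
  have h' := H10.grad_eq_zero_of_toL2_eq_zero hΘ h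
  refine Subtype.ext ?_
  exact (WithLp.ext_iff ..).2 (Prod.ext h h')

/-! ### A coefficient that is Lipschitz in time. -/

theorem ae_eq_zero_of_forall_setIntegral_prod_eq_zero {α β : Type*} [MeasurableSpace α]
    [MeasurableSpace β] {ρ : Measure (α × β)} {f : α × β → ℝ} (hf : Integrable f ρ)
    (h : ∀ (s : Set α) (t : Set β), MeasurableSet s → MeasurableSet t →
      ∫ p in s ×ˢ t, f p ∂ρ = 0) : f =ᵐ[ρ] 0 := by
  refine hf.ae_eq_zero_of_forall_setIntegral_eq_zero fun s hs hlt => ?_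
  -- Finite measure is not stable under the operations of the π-λ induction, and is not needed since
  -- `f` is integrable.
  clear hlt
  induction s, hs using MeasurableSpace.induction_on_inter generateFrom_prod.symm isPiSystem_prod with
  | empty => simp
  | basic s hs =>
    obtain ⟨s, hs, t, ht, rfl⟩ := hs
    exact h s t hs ht
  | compl s hs ih =>
    have h1 := integral_add_compl hs hf
    have h2 := h univ univ MeasurableSet.univ MeasurableSet.univ
    rw [univ_prod_univ, Measure.restrict_univ] at h2
    linarith
  | iUnion s hd hs ih =>
    rw [integral_iUnion hs hd hf.integrableOn]
    simp [ih]

/-- Truncating a measurable representative at the essential supremum makes the bound hold at every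
point, so time slices carry it without exceptional sets. -/
theorem MeasureTheory.MemLp.exists_bounded_ae_eq {α : Type*} [MeasurableSpace α] {ρ : Measure α}
    {g : α → ℝ} (hg : MemLp g ⊤ ρ) :
    ∃ g₀ : α → ℝ, Measurable g₀ ∧ (∃ C, 0 ≤ C ∧ ∀ x, |g₀ x| ≤ C) ∧ g =ᵐ[ρ] g₀ := by
  set C := (eLpNormEssSup g ρ).toReal with hC
  have hC0 : 0 ≤ C := ENNReal.toReal_nonneg
  have hfin : eLpNormEssSup g ρ < ⊤ := by
    have := hg.2
    rwa [eLpNorm_exponent_top] at this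
  refine ⟨fun x => max (-C) (min C (hg.1.mk g x)),
    measurable_const.max (measurable_const.min hg.1.stronglyMeasurable_mk.measurable),
    ⟨C, hC0, fun x => ?_⟩, ?_⟩
  · rw [abs_le]
    exact ⟨le_max_left _ _, max_le (by linarith) (min_le_left _ _)⟩
  · filter_upwards [hg.1.ae_eq_mk, ae_le_eLpNormEssSup (f := g) (μ := ρ)] with x hx hb
    have : |g x| ≤ C := by
      have := ENNReal.toReal_mono hfin.ne hb
      simpa using this
    rw [← hx, min_eq_right (abs_le.1 this).2, max_eq_right (abs_le.1 this).1]

section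

variable {E : Type*} [MeasurableSpace E]

theorem abs_integral_sub_integral_le {b : ℝ → ℝ} {C : ℝ} (hb : Measurable b)
    (hC : ∀ t, |b t| ≤ C) (s t : ℝ) :
    |(∫ r in (0 : ℝ)..t, b r) - ∫ r in (0 : ℝ)..s, b r| ≤ C * |t - s| := by
  have hi : ∀ u w : ℝ, IntervalIntegrable b volume u w := fun u w =>
    (intervalIntegrable_const (c := C)).mono_fun' hb.aestronglyMeasurable (ae_of_all _ hC)
  rw [intervalIntegral.integral_interval_sub_left (hi _ _) (hi _ _)]
  exact intervalIntegral.norm_integral_le_of_norm_le_const (f := b) (C := C) fun r _ => hC r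

/-- A Carathéodory function: continuous in time and measurable in space, hence jointly measurable.
-/
theorem measurable_uncurry_primitive {b : E × ℝ → ℝ} {C : ℝ} (hb : Measurable b)
    (hC : ∀ p, |b p| ≤ C) : Measurable fun p : E × ℝ => ∫ s in (0 : ℝ)..p.2, b (p.1, s) := by
  have h := measurable_uncurry_of_continuous_of_measurable
    (m := ‹_›) (u := fun (t : ℝ) (x : E) => ∫ s in (0 : ℝ)..t, b (x, s)) (fun x => ?_) (fun t => ?_)
  · exact h.comp measurable_swap
  · have : LipschitzWith C.toNNReal fun t => ∫ s in (0 : ℝ)..t, b (x, s) :=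
      LipschitzWith.of_dist_le_mul fun t s => by
        rw [Real.dist_eq, Real.dist_eq]
        refine (abs_integral_sub_integral_le (hb.comp measurable_prodMk_left)
          (fun r => hC (x, r)) s t).trans ?_
        gcongr
        exact Real.le_coe_toNNReal C
    exact this.continuous
  · simp only [intervalIntegral]
    exact (hb.stronglyMeasurable.integral_prod_right' (ν := volume.restrict (Ioc 0 t))).measurable.sub
      (hb.stronglyMeasurable.integral_prod_right' (ν := volume.restrict (Ioc t 0))).measurable

/-- A bounded function on `E × (0,T)` with bounded weak derivative in time is a.e. a primitive of
that derivative. -/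
theorem ae_prod_eq_add_primitive {m : Measure E} [IsFiniteMeasure m] {T : ℝ} (hT : 0 < T)
    {a b : E × ℝ → ℝ} (ha : Measurable a) (hb : Measurable b) {Ca Cb : ℝ}
    (hCa : ∀ p, |a p| ≤ Ca) (hCb : ∀ p, |b p| ≤ Cb)
    (h : ∀ η : ℝ → ℝ, IsTestFunction (Ioo 0 T) η → ∀ᵐ x ∂m,
      ∫ t in Ioo 0 T, deriv η t * a (x, t) = -∫ t in Ioo 0 T, η t * b (x, t)) :
    ∃ c : E → ℝ, Measurable c ∧ ∀ᵐ p ∂m.prod (volume.restrict (Ioo 0 T)),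
      a p = c p.1 + ∫ s in (0 : ℝ)..p.2, b (p.1, s) := by
  set ν := volume.restrict (Ioo (0 : ℝ) T) with hν
  obtain ⟨η₀, hη₀, hη₀1⟩ := exists_isTestFunction_integral_eq_one hT
  set B : E × ℝ → ℝ := fun p => ∫ s in (0 : ℝ)..p.2, b (p.1, s) with hB
  have hBm : Measurable B := measurable_uncurry_primitive hb hCb
  have hint : ∀ (m' : Measure E) [IsFiniteMeasure m'] {g : E × ℝ → ℝ} {C : ℝ}, Measurable g →
      (∀ p, |g p| ≤ C) → Integrable g (m'.prod ν) := fun m' _ g C hg hC =>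
    Integrable.of_bound hg.aestronglyMeasurable C (ae_of_all _ hC)
  have hBb : ∀ p : E × ℝ, p.2 ∈ Ioo 0 T → |B p| ≤ Cb * T := fun p hp => by
    have := abs_integral_sub_integral_le (hb.comp (measurable_prodMk_left (x := p.1)))
      (fun r => hCb (p.1, r)) 0 p.2
    rw [intervalIntegral.integral_same, sub_zero, sub_zero, abs_of_pos hp.1] at this
    have hCb0 : 0 ≤ Cb := (abs_nonneg _).trans (hCb p)
    exact this.trans (by gcongr; exact hp.2.le)
  have hBi : ∀ (m' : Measure E) [IsFiniteMeasure m'], Integrable B (m'.prod ν) := by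
    intro m' _
    refine Integrable.of_bound hBm.aestronglyMeasurable (Cb * T) ?_
    have : ∀ᵐ p : E × ℝ ∂m'.prod ν, p.2 ∈ Ioo 0 T :=
      Measure.quasiMeasurePreserving_snd.ae (ae_restrict_mem measurableSet_Ioo)
    filter_upwards [this] with p hp using hBb p hp
  have hη₀c : ∃ C, ∀ t, |η₀ t| ≤ C :=
    hη₀.1.continuous.bounded_above_of_compact_support hη₀.2.1
  obtain ⟨Cη, hCη⟩ := hη₀c
  have hη₀m : Measurable η₀ := hη₀.1.continuous.measurable
  have hci : ∀ (m' : Measure E) [IsFiniteMeasure m'],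
      Integrable (fun p : E × ℝ => η₀ p.2 * (a p - B p)) (m'.prod ν) := fun m' _ =>
    ((hint m' ha hCa).sub (hBi m')).bdd_mul (hη₀m.comp measurable_snd).aestronglyMeasurable
      (ae_of_all _ fun p => hCη p.2)
  -- The du Bois-Reymond constant of each slice. Its explicit formula gives measurability in `x`.
  set c : E → ℝ := fun x => ∫ r, η₀ r * (a (x, r) - B (x, r)) ∂ν with hc
  have hcm : Measurable c := by
    have : StronglyMeasurable fun p : E × ℝ => η₀ p.2 * (a p - B p) :=
      ((hη₀m.comp measurable_snd).mul (ha.sub hBm)).stronglyMeasurable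
    exact this.integral_prod_right'.measurable
  refine ⟨c, hcm, ?_⟩
  have hcint : ∀ (m' : Measure E) [IsFiniteMeasure m'], Integrable c m' := fun m' _ =>
    (hci m').integral_prod_left
  -- The null set of `x` in `h` depends on `η`. Integrating over `A` first removes it, and the
  -- scalar du Bois-Reymond lemma applies for each `A`; rectangles then determine the function.
  have key : ∀ A : Set E, MeasurableSet A → ∀ᵐ t ∂ν,
      ∫ x in A, (a (x, t) - (c x + B (x, t))) ∂m = 0 := by
    intro A hA
    set mA := m.restrict A with hmA
    set g : ℝ → ℝ := fun t => ∫ x, a (x, t) ∂mA with hg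
    set k : ℝ → ℝ := fun t => ∫ x, b (x, t) ∂mA with hk
    have hweak : ∀ η : ℝ → ℝ, IsTestFunction (Ioo 0 T) η →
        ∫ t in Ioo 0 T, deriv η t • g t = -∫ t in Ioo 0 T, η t • k t := by
      intro η hη
      have hs : ∀ {θ : ℝ → ℝ}, IsTestFunction (Ioo 0 T) θ → ∀ {u : E × ℝ → ℝ} {C : ℝ},
          Measurable u → (∀ p, |u p| ≤ C) →
          ∫ t, θ t • (∫ x, u (x, t) ∂mA) ∂ν = ∫ x, ∫ t, θ t * u (x, t) ∂ν ∂mA := by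
        intro θ hθ u C hu hC
        obtain ⟨Cθ, hCθ⟩ := hθ.1.continuous.bounded_above_of_compact_support hθ.2.1
        have hi : Integrable (fun p : E × ℝ => θ p.2 * u p) (mA.prod ν) :=
          (hint mA hu hC).bdd_mul
            (hθ.1.continuous.measurable.comp measurable_snd).aestronglyMeasurable
            (ae_of_all _ fun p => hCθ p.2)
        rw [integral_integral_swap (f := fun x t => θ t * u (x, t)) hi]
        simp_rw [integral_const_mul, smul_eq_mul]
      rw [hs hη.deriv ha hCa, hs hη hb hCb, ← integral_neg]
      exact integral_congr_ae (ae_restrict_of_ae (h η hη))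
    have hgi : IntegrableOn g (Ioo 0 T) := (hint mA ha hCa).integral_prod_right
    have hki : IntegrableOn k (Ioo 0 T) := (hint mA hb hCb).integral_prod_right
    have hae := ae_eq_add_primitive_of_weakDeriv hT hgi hki hweak hη₀ hη₀1
    have hBk : ∀ t ∈ Ioo 0 T, ∫ x, B (x, t) ∂mA = ∫ s in (0 : ℝ)..t, k s := by
      intro t ht
      simp only [hB, hk]
      rw [intervalIntegral.integral_of_le ht.1.le]
      simp_rw [intervalIntegral.integral_of_le ht.1.le]
      exact integral_integral_swap (f := fun x s => b (x, s))
        (Integrable.of_bound hb.aestronglyMeasurable Cb (ae_of_all _ hCb))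
    have hcA : ∫ x, c x ∂mA = ∫ r in Ioo 0 T, η₀ r • (g r - ∫ s in (0 : ℝ)..r, k s) := by
      simp only [hc]
      rw [integral_integral_swap (f := fun x r => η₀ r * (a (x, r) - B (x, r))) (hci mA)]
      have hsl := (hBi mA).prod_left_ae
      refine integral_congr_ae ?_
      filter_upwards [ae_restrict_mem measurableSet_Ioo, hsl, (hint mA ha hCa).prod_left_ae]
        with r hr h1 h2
      rw [integral_const_mul, integral_sub h2 h1, hBk r hr, smul_eq_mul]
    filter_upwards [ae_restrict_mem measurableSet_Ioo, ae_restrict_of_ae hae,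
      (hBi mA).prod_left_ae, (hint mA ha hCa).prod_left_ae] with t ht h1 h2 h3
    rw [integral_sub h3 (g := fun x => c x + B (x, t)) ((hcint mA).add h2), integral_add (hcint mA) h2, hBk t ht, hcA, ← h1 ht,
      sub_self]
  have hd : Integrable (fun p : E × ℝ => a p - (c p.1 + B p)) (m.prod ν) :=
    (hint m ha hCa).sub (((hcint m).comp_fst ν).add (hBi m))
  have hzero := ae_eq_zero_of_forall_setIntegral_prod_eq_zero hd fun A S hA hS => by
    rw [← Measure.prod_restrict, integral_prod_symm]
    · exact integral_eq_zero_of_ae (ae_restrict_of_ae (key A hA))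
    · rw [Measure.prod_restrict]
      exact hd.integrableOn
  filter_upwards [hzero] with p hp
  have : a p - (c p.1 + B p) = 0 := hp
  linarith

end

theorem IsTestFunction.mul_prod {E F : Type*} [NormedAddCommGroup E] [NormedSpace ℝ E]
    [NormedAddCommGroup F] [NormedSpace ℝ F] {A : Set E} {B : Set F} {ζ : E → ℝ} {η : F → ℝ}
    (hζ : IsTestFunction A ζ) (hη : IsTestFunction B η) :
    IsTestFunction (A ×ˢ B) (fun p : E × F => ζ p.1 * η p.2) := by
  have hsub : tsupport (fun p : E × F => ζ p.1 * η p.2) ⊆ tsupport ζ ×ˢ tsupport η := by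
    refine closure_minimal (fun p hp => ?_) ((isClosed_tsupport _).prod (isClosed_tsupport _))
    have hp' : ζ p.1 * η p.2 ≠ 0 := hp
    exact ⟨subset_tsupport _ (left_ne_zero_of_mul hp'), subset_tsupport _ (right_ne_zero_of_mul hp')⟩
  refine ⟨?_, ?_, hsub.trans (prod_mono hζ.2.2 hη.2.2)⟩
  · exact (hζ.1.comp contDiff_fst).mul (hη.1.comp contDiff_snd)
  · exact (IsCompact.prod hζ.2.1 hη.2.1).of_isClosed_subset (isClosed_tsupport _) hsub

theorem volume_restrict_prod {d : ℕ} (Θ : Set (EuclideanSpace ℝ (Fin d))) (I : Set ℝ) :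
    (volume : Measure (EuclideanSpace ℝ (Fin d) × ℝ)).restrict (Θ ×ˢ I) =
      (volume.restrict Θ).prod (volume.restrict I) := by
  rw [Measure.volume_eq_prod, Measure.prod_restrict]

/-- A weak time derivative may be tested slicewise. -/
theorem HasWeakPartialTimeDeriv.ae_integral_deriv_mul_eq {d : ℕ}
    {Θ : Set (EuclideanSpace ℝ (Fin d))} (hΘ : IsOpen Θ) (hΘb : Bornology.IsBounded Θ) {T : ℝ}
    {β b β₁ b₁ : EuclideanSpace ℝ (Fin d) × ℝ → ℝ} (h : HasWeakPartialTimeDeriv Θ T β b)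
    (hβ : β =ᵐ[volume.restrict (Θ ×ˢ Ioo 0 T)] β₁) (hb : b =ᵐ[volume.restrict (Θ ×ˢ Ioo 0 T)] b₁)
    (hβm : Measurable β₁) (hbm : Measurable b₁) {Cβ Cb : ℝ} (hCβ : ∀ p, |β₁ p| ≤ Cβ)
    (hCb : ∀ p, |b₁ p| ≤ Cb) {η : ℝ → ℝ} (hη : IsTestFunction (Ioo 0 T) η) :
    ∀ᵐ x ∂volume.restrict Θ,
      ∫ t in Ioo 0 T, deriv η t * β₁ (x, t) = -∫ t in Ioo 0 T, η t * b₁ (x, t) := by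
  set m := (volume : Measure (EuclideanSpace ℝ (Fin d))).restrict Θ with hm
  set ν := volume.restrict (Ioo (0 : ℝ) T) with hν
  have : IsFiniteMeasure m := ⟨by
    rw [hm, Measure.restrict_apply_univ]; exact hΘb.measure_lt_top⟩
  have hi : ∀ {θ : ℝ → ℝ}, IsTestFunction (Ioo 0 T) θ →
      ∀ {u : EuclideanSpace ℝ (Fin d) × ℝ → ℝ} {C : ℝ},
      Measurable u → (∀ p, |u p| ≤ C) →
      Integrable (fun p : EuclideanSpace ℝ (Fin d) × ℝ => θ p.2 * u p) (m.prod ν) := by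
    intro θ hθ u C hu hC
    obtain ⟨Cθ, hCθ⟩ := hθ.1.continuous.bounded_above_of_compact_support hθ.2.1
    exact (Integrable.of_bound hu.aestronglyMeasurable C (ae_of_all _ hC)).bdd_mul
      (hθ.1.continuous.measurable.comp measurable_snd).aestronglyMeasurable
      (ae_of_all _ fun p => hCθ p.2)
  -- The residual of the slice identity; testing it with `ζ(x)` is testing the weak derivative with
  -- `ζ(x) η(t)`.
  set g : EuclideanSpace ℝ (Fin d) → ℝ := fun x =>
    (∫ t, deriv η t * β₁ (x, t) ∂ν) + ∫ t, η t * b₁ (x, t) ∂ν with hg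
  have hgi : Integrable g m :=
    (hi hη.deriv hβm hCβ).integral_prod_left.add (hi hη hbm hCb).integral_prod_left
  have key : ∀ᵐ x, x ∈ Θ → g x = 0 := by
    refine hΘ.ae_eq_zero_of_integral_contDiff_smul_eq_zero (f := g)
      (locallyIntegrableOn_of_locallyIntegrable_restrict hgi.locallyIntegrable)
      fun ζ h1 h2 h3 => ?_
    have hζ : IsTestFunction Θ ζ := ⟨h1, h2, h3⟩
    rw [← hζ.setIntegral_smul_eq]
    have hw := h _ (hζ.mul_prod hη)
    obtain ⟨Cζ, hCζ⟩ := hζ.1.continuous.bounded_above_of_compact_support hζ.2.1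
    have hF : ∀ {θ : ℝ → ℝ}, IsTestFunction (Ioo 0 T) θ →
        ∀ {u : EuclideanSpace ℝ (Fin d) × ℝ → ℝ} {C : ℝ},
        Measurable u → (∀ p, |u p| ≤ C) →
        ∫ p, ζ p.1 * (θ p.2 * u p) ∂m.prod ν = ∫ x, ζ x • ∫ t, θ t * u (x, t) ∂ν ∂m := by
      intro θ hθ u C hu hC
      rw [integral_prod]
      · simp_rw [integral_const_mul, smul_eq_mul]
      · exact (hi hθ hu hC).bdd_mul
          (hζ.1.continuous.measurable.comp measurable_fst).aestronglyMeasurable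
          (ae_of_all _ fun p => hCζ p.1)
    have e1 : ∫ p in Θ ×ˢ Ioo 0 T, β p * deriv (fun s => ζ p.1 * η s) p.2 =
        ∫ p, ζ p.1 * (deriv η p.2 * β₁ p) ∂m.prod ν := by
      rw [← volume_restrict_prod]
      refine integral_congr_ae ?_
      filter_upwards [hβ] with p hp
      rw [deriv_const_mul_field, hp]
      ring
    have e2 : ∫ p in Θ ×ˢ Ioo 0 T, b p * (ζ p.1 * η p.2) =
        ∫ p, ζ p.1 * (η p.2 * b₁ p) ∂m.prod ν := by
      rw [← volume_restrict_prod]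
      refine integral_congr_ae ?_
      filter_upwards [hb] with p hp
      rw [hp]
      ring
    rw [e1, e2, hF hη.deriv hβm hCβ, hF hη hbm hCb] at hw
    simp only [hg, smul_add]
    rw [integral_add (hζ.integrable_smul (hi hη.deriv hβm hCβ).integral_prod_left)
      (hζ.integrable_smul (hi hη hbm hCb).integral_prod_left), hw, neg_add_cancel]
  rw [hm, ae_restrict_iff' hΘ.measurableSet]
  filter_upwards [key] with x hx hxΘ
  have : _ + _ = (0 : ℝ) := hx hxΘ
  linarith

/-- An elliptic coefficient with bounded weak time derivative has a representative which is bounded,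
elliptic, and Lipschitz continuous in time at every point. -/
theorem HasWeakPartialTimeDeriv.exists_lipschitz_representative {d : ℕ}
    {Θ : Set (EuclideanSpace ℝ (Fin d))} (hΘ : IsOpen Θ) (hΘb : Bornology.IsBounded Θ)
    {T : ℝ} (hT : 0 < T) {β b : EuclideanSpace ℝ (Fin d) × ℝ → ℝ} (hβ : IsLinfty Θ T β)
    (hb : IsLinfty Θ T b) (h : HasWeakPartialTimeDeriv Θ T β b) {β₀ : ℝ}
    (hell : ∀ᵐ p ∂volume.restrict (Θ ×ˢ Ioo 0 T), β₀ ≤ β p) :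
    ∃ (M : ℝ) (γ : ℝ → EuclideanSpace ℝ (Fin d) → ℝ), 0 ≤ M ∧ (∀ t, Measurable (γ t)) ∧
      (∀ t x, |γ t x| ≤ M) ∧ (∀ s t x, |γ t x - γ s x| ≤ M * |t - s|) ∧ (∀ t x, β₀ ≤ γ t x) ∧
      ∀ᵐ t ∂volume.restrict (Ioo 0 T), ∀ᵐ x ∂volume.restrict Θ, β (x, t) = γ t x := by
  obtain ⟨β₁, hβ₁m, ⟨Cβ, hCβ0, hCβ⟩, hβ₁⟩ := MemLp.exists_bounded_ae_eq hβ
  obtain ⟨b₁, hb₁m, ⟨Cb, hCb0, hCb⟩, hb₁⟩ := MemLp.exists_bounded_ae_eq hb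
  have : IsFiniteMeasure ((volume : Measure (EuclideanSpace ℝ (Fin d))).restrict Θ) := ⟨by
    rw [Measure.restrict_apply_univ]; exact hΘb.measure_lt_top⟩
  obtain ⟨c, hcm, hc⟩ := ae_prod_eq_add_primitive (m := volume.restrict Θ) hT hβ₁m hb₁m hCβ hCb
    fun η hη => h.ae_integral_deriv_mul_eq hΘ hΘb hβ₁ hb₁ hβ₁m hb₁m hCβ hCb hη
  set B : EuclideanSpace ℝ (Fin d) × ℝ → ℝ := fun p => ∫ s in (0 : ℝ)..p.2, b₁ (p.1, s) with hB
  have hBm : Measurable B := measurable_uncurry_primitive hb₁m hCb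
  -- Truncation forces ellipticity and boundedness everywhere, preserves the Lipschitz constant
  -- `Cb`, and changes nothing almost everywhere because `β₀ ≤ β ≤ Cβ` there.
  refine ⟨max (max |β₀| Cβ) Cb, fun t x => max β₀ (min (max β₀ Cβ) (c x + B (x, t))), ?_, ?_, ?_, ?_,
    fun t x => le_max_left _ _, ?_⟩
  · positivity
  · intro t
    exact measurable_const.max (measurable_const.min
      (hcm.add (hBm.comp measurable_prodMk_right)))
  · intro t x
    refine le_trans ?_ (le_max_left _ _)
    rw [abs_le]
    refine ⟨(neg_le_neg (le_max_left _ _)).trans ((neg_abs_le β₀).trans (le_max_left _ _)),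
      max_le ((le_abs_self β₀).trans (le_max_left _ _)) ?_⟩
    exact (min_le_left _ _).trans (max_le_max_right _ (le_abs_self β₀))
  · intro s t x
    refine (abs_max_sub_max_le_max _ _ _ _).trans ?_
    rw [sub_self, abs_zero]
    refine max_le (by positivity) ((abs_min_sub_min_le_max _ _ _ _).trans ?_)
    rw [sub_self, abs_zero]
    refine max_le (by positivity) ?_
    rw [add_sub_add_left_eq_sub]
    refine (abs_integral_sub_integral_le (hb₁m.comp measurable_prodMk_left)
      (fun r => hCb (x, r)) s t).trans ?_
    gcongr
    exact le_max_right _ _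
  · have hall : ∀ᵐ p ∂(volume.restrict Θ).prod (volume.restrict (Ioo 0 T)),
        β p = max β₀ (min (max β₀ Cβ) (c p.1 + B p)) := by
      rw [← volume_restrict_prod] at hc ⊢
      filter_upwards [hc, hβ₁, hell] with p h1 h2 h3
      have h4 : c p.1 + B p = β p := by rw [h2, h1]
      have h5 : β p ≤ Cβ := by rw [h2]; exact (le_abs_self _).trans (hCβ p)
      rw [h4, min_eq_right (h5.trans (le_max_right _ _)), max_eq_right h3]
    exact Measure.ae_ae_of_ae_prod (Measure.measurePreserving_swap.quasiMeasurePreserving.ae hall)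

/-! ### Multiplication operators on `L²(Θ)^d`. -/

section Multiplication

variable {d : ℕ} {Θ : Set (EuclideanSpace ℝ (Fin d))}

/-- The operator of multiplication by a bounded function on `L²(Θ)^d`. -/
noncomputable def L2Vec.mulOp {g : EuclideanSpace ℝ (Fin d) → ℝ} (hg : MemLp g ⊤ (volume.restrict Θ)) :
    L2Vec Θ →L[ℝ] L2Vec Θ :=
  (ContinuousLinearMap.lsmul ℝ ℝ).holderL (volume.restrict Θ) ⊤ 2 2 (hg.toLp g)

theorem L2Vec.coeFn_mulOp {g : EuclideanSpace ℝ (Fin d) → ℝ}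
    (hg : MemLp g ⊤ (volume.restrict Θ)) (u : L2Vec Θ) :
    L2Vec.mulOp hg u =ᵐ[volume.restrict Θ] fun x => g x • u x := by
  filter_upwards [(ContinuousLinearMap.lsmul ℝ ℝ).coeFn_holder (r := 2) (hg.toLp g) u,
    hg.coeFn_toLp] with x h1 h2
  refine h1.trans ?_
  rw [h2]
  rfl

theorem L2Vec.inner_mulOp {g : EuclideanSpace ℝ (Fin d) → ℝ}
    (hg : MemLp g ⊤ (volume.restrict Θ)) (u v : L2Vec Θ) :
    inner ℝ (L2Vec.mulOp hg u) v = ∫ x in Θ, g x * inner ℝ (u x) (v x) := by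
  rw [L2.inner_def]
  refine integral_congr_ae ?_
  filter_upwards [L2Vec.coeFn_mulOp hg u] with x hx
  rw [hx, real_inner_smul_left]

theorem L2Vec.inner_mulOp_comm {g : EuclideanSpace ℝ (Fin d) → ℝ}
    (hg : MemLp g ⊤ (volume.restrict Θ)) (u v : L2Vec Θ) :
    inner ℝ (L2Vec.mulOp hg u) v = inner ℝ u (L2Vec.mulOp hg v) := by
  rw [L2Vec.inner_mulOp, real_inner_comm, L2Vec.inner_mulOp]
  simp_rw [real_inner_comm]

theorem L2Vec.norm_mulOp_sub_le {g h : EuclideanSpace ℝ (Fin d) → ℝ}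
    (hg : MemLp g ⊤ (volume.restrict Θ)) (hh : MemLp h ⊤ (volume.restrict Θ)) {C : ℝ}
    (hC0 : 0 ≤ C) (hC : ∀ x, |g x - h x| ≤ C) : ‖L2Vec.mulOp hg - L2Vec.mulOp hh‖ ≤ C := by
  refine ContinuousLinearMap.opNorm_le_bound _ hC0 fun u => ?_
  refine Lp.norm_le_mul_norm_of_ae_le_mul ?_
  filter_upwards [Lp.coeFn_sub (L2Vec.mulOp hg u) (L2Vec.mulOp hh u), L2Vec.coeFn_mulOp hg u,
    L2Vec.coeFn_mulOp hh u] with x h1 h2 h3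
  rw [_root_.sub_apply, h1, Pi.sub_apply, h2, h3, ← sub_smul, norm_smul]
  gcongr
  exact hC x

theorem L2Vec.mul_norm_sq_le_inner_mulOp {g : EuclideanSpace ℝ (Fin d) → ℝ}
    (hg : MemLp g ⊤ (volume.restrict Θ)) {c : ℝ} (hc : ∀ x, c ≤ g x) (u : L2Vec Θ) :
    c * ‖u‖ ^ 2 ≤ inner ℝ (L2Vec.mulOp hg u) u := by
  rw [← real_inner_self_eq_norm_sq, L2.inner_def, ← integral_const_mul, L2.inner_def]
  refine integral_mono_ae ((L2.integrable_inner u u).const_mul c)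
    (L2.integrable_inner (L2Vec.mulOp hg u) u) ?_
  filter_upwards [L2Vec.coeFn_mulOp hg u] with x hx
  rw [hx, real_inner_smul_left]
  exact mul_le_mul_of_nonneg_right (hc x) real_inner_self_nonneg

end Multiplication

/-! ### Bounds for the Caputo derivative. -/

section Caputo

theorem intervalIntegrable_sub_rpow_neg {m : ℝ} (hm : m < 1) (t : ℝ) :
    IntervalIntegrable (fun r => (t - r) ^ (-m)) volume 0 t := by
  have h := (intervalIntegral.intervalIntegrable_rpow' (a := 0) (b := t) (r := -m)
    (by linarith)).comp_sub_left t
  simpa using h.symm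

theorem integral_sub_rpow_neg {m : ℝ} (hm : m < 1) (t : ℝ) :
    ∫ r in (0 : ℝ)..t, (t - r) ^ (-m) = t ^ (1 - m) / (1 - m) := by
  rw [intervalIntegral.integral_comp_sub_left (fun r => r ^ (-m)), sub_self, sub_zero,
    integral_rpow (Or.inl (by linarith)), Real.zero_rpow (by linarith), sub_zero,
    neg_add_eq_sub]

variable {X : Type*} [NormedAddCommGroup X] [NormedSpace ℝ X]

theorem intervalIntegrable_caputo_kernel_smul {m t : ℝ} (hm : m < 1) {Ψ : ℝ → X}
    (hΨ : ContinuousOn Ψ (uIcc 0 t)) :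
    IntervalIntegrable (fun r => (t - r) ^ (-m) • Ψ r) volume 0 t :=
  (intervalIntegrable_sub_rpow_neg hm t).smul_continuousOn hΨ

theorem caputo_sub {μ : ℝ → ℝ} {t : ℝ} (hμ : μ t < 1) {Ψ₁ Ψ₂ : ℝ → X}
    (h₁ : ContinuousOn Ψ₁ (uIcc 0 t)) (h₂ : ContinuousOn Ψ₂ (uIcc 0 t)) :
    caputo μ (fun r => Ψ₁ r - Ψ₂ r) t = caputo μ Ψ₁ t - caputo μ Ψ₂ t := by
  simp only [caputo, smul_sub]
  rw [intervalIntegral.integral_sub (intervalIntegrable_caputo_kernel_smul hμ h₁)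
    (intervalIntegrable_caputo_kernel_smul hμ h₂), smul_sub]

/-- The argument stays in the compact interval `[1 - b, 1]`, where the Gamma function is continuous
and positive. -/
theorem exists_bound_inv_Gamma_one_sub {b : ℝ} (hb : b < 1) :
    ∃ C, 0 ≤ C ∧ ∀ m ∈ Icc 0 b, |(Real.Gamma (1 - m))⁻¹| ≤ C := by
  have hc : ContinuousOn (fun m : ℝ => (Real.Gamma (1 - m))⁻¹) (Icc 0 b) := by
    intro m hm
    have hpos : 0 < 1 - m := by linarith [hm.2]
    have h1 : ContinuousAt Real.Gamma (1 - m) :=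
      (Real.differentiableAt_Gamma fun k hk => by
        have : (0 : ℝ) ≤ k := k.cast_nonneg
        linarith).continuousAt
    have h2 : ContinuousAt (fun m : ℝ => Real.Gamma (1 - m)) m :=
      ContinuousAt.comp (f := fun m : ℝ => 1 - m) h1 (by fun_prop)
    exact (h2.inv₀ (Real.Gamma_pos_of_pos hpos).ne').continuousWithinAt
  obtain ⟨C, hC⟩ := isCompact_Icc.exists_bound_of_continuousOn hc
  exact ⟨max C 0, le_max_right _ _, fun m hm => (hC m hm).trans (le_max_left _ _)⟩

/-- The kernel has mass `t^(1 - μ) / (1 - μ)`, at most `max 1 T / (1 - b)`. The constant depends on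
neither the order nor the time, so no regularity of `μ` in time is involved. -/
theorem exists_norm_caputo_le {b T : ℝ} (hb : b < 1) (X : Type*) [NormedAddCommGroup X]
    [NormedSpace ℝ X] : ∃ C, 0 ≤ C ∧ ∀ (μ : ℝ → ℝ) (Ψ : ℝ → X) (t q : ℝ), μ t ∈ Icc 0 b →
      t ∈ Icc 0 T → (∀ r ∈ Icc 0 t, ‖Ψ r‖ ≤ q) → ‖caputo μ Ψ t‖ ≤ C * q := by
  obtain ⟨C, hC0, hC⟩ := exists_bound_inv_Gamma_one_sub hb
  have h1b : 0 < 1 - b := by linarith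
  refine ⟨C * (max 1 T / (1 - b)), by positivity, fun μ Ψ t q hμ ht hq => ?_⟩
  have hμ1 : μ t < 1 := hμ.2.trans_lt hb
  have hq0 : 0 ≤ q := (norm_nonneg _).trans (hq 0 ⟨le_rfl, ht.1⟩)
  have h1 : ‖∫ r in (0 : ℝ)..t, ((t - r) ^ (-μ t)) • Ψ r‖ ≤
      ∫ r in (0 : ℝ)..t, (t - r) ^ (-μ t) * q := by
    refine intervalIntegral.norm_integral_le_of_norm_le ht.1 (ae_of_all _ fun r hr => ?_)
      ((intervalIntegrable_sub_rpow_neg hμ1 t).mul_const q)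
    have : 0 ≤ (t - r) ^ (-μ t) := Real.rpow_nonneg (by linarith [hr.2]) _
    rw [norm_smul, Real.norm_of_nonneg this]
    gcongr
    exact hq r ⟨hr.1.le, hr.2⟩
  rw [intervalIntegral.integral_mul_const, integral_sub_rpow_neg hμ1] at h1
  -- With a base at least `1`, the exponent can be raised to `1`.
  have h2 : t ^ (1 - μ t) ≤ max 1 T := by
    calc t ^ (1 - μ t) ≤ (max 1 T) ^ (1 - μ t) :=
          Real.rpow_le_rpow ht.1 (ht.2.trans (le_max_right _ _)) (by linarith)
      _ ≤ (max 1 T) ^ (1 : ℝ) :=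
          Real.rpow_le_rpow_of_exponent_le (le_max_left _ _) (by linarith [hμ.1])
      _ = _ := Real.rpow_one _
  have h3 : t ^ (1 - μ t) / (1 - μ t) ≤ max 1 T / (1 - b) :=
    div_le_div₀ (by positivity) h2 h1b (by linarith [hμ.2])
  rw [caputo, norm_smul]
  calc _ ≤ C * (t ^ (1 - μ t) / (1 - μ t) * q) := by
        gcongr
        exact hC _ hμ
    _ ≤ C * (max 1 T / (1 - b) * q) := by gcongr
    _ = _ := by ring

end Caputo

/-! ### Lower order terms and the integrated equation. -/

theorem abs_integral_mul_sub_integral_mul_le {α : Type*} [MeasurableSpace α] {m : Measure α}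
    {F₁ F₂ : α → ℝ} (h₁ : MemLp F₁ 2 m) (h₂ : MemLp F₂ 2 m) {w χ : Lp ℝ 2 m} {C : ℝ}
    (h : ∀ᵐ x ∂m, |F₁ x - F₂ x| ≤ C * |w x|) :
    |(∫ x, F₁ x * χ x ∂m) - ∫ x, F₂ x * χ x ∂m| ≤ C * ‖w‖ * ‖χ‖ := by
  have e : ∀ {F : α → ℝ} (hF : MemLp F 2 m), ∫ x, F x * χ x ∂m = inner ℝ (hF.toLp F) χ := by
    intro F hF
    rw [L2.inner_def]
    refine integral_congr_ae ?_
    filter_upwards [hF.coeFn_toLp] with x hx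
    rw [hx]
    simp [mul_comm]
  rw [e h₁, e h₂, ← inner_sub_left]
  refine (abs_real_inner_le_norm _ _).trans ?_
  gcongr
  refine Lp.norm_le_mul_norm_of_ae_le_mul ?_
  filter_upwards [Lp.coeFn_sub (h₁.toLp F₁) (h₂.toLp F₂), h₁.coeFn_toLp, h₂.coeFn_toLp, h]
    with x e1 e2 e3 e4
  rw [e1, Pi.sub_apply, e2, e3]
  exact e4

theorem abs_integral_lipschitz_comp_sub_le {α : Type*} [MeasurableSpace α] {m : Measure α}
    [IsFiniteMeasure m] {f : ℝ → ℝ} {C : ℝ} (hC : 0 ≤ C)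
    (hf : ∀ z₁ z₂ : ℝ, |f z₁ - f z₂| ≤ C * |z₁ - z₂|) (u₁ u₂ χ : Lp ℝ 2 m) :
    |(∫ x, f (u₁ x) * χ x ∂m) - ∫ x, f (u₂ x) * χ x ∂m| ≤ C * ‖u₁ - u₂‖ * ‖χ‖ := by
  have hfc : Continuous f := by
    have : LipschitzWith C.toNNReal f := LipschitzWith.of_dist_le_mul fun x y => by
      rw [Real.dist_eq, Real.dist_eq, Real.coe_toNNReal C hC]
      exact hf x y
    exact this.continuous
  have hmem : ∀ u : Lp ℝ 2 m, MemLp (fun x => f (u x)) 2 m := fun u => by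
    -- Linear growth of `f`; the constant `|f 0|` is square integrable because the measure is
    -- finite.
    refine ((memLp_const |f 0|).add ((Lp.memLp u).norm.const_mul C)).mono'
      (hfc.comp_aestronglyMeasurable (Lp.aestronglyMeasurable u)) (ae_of_all _ fun x => ?_)
    have := hf (u x) 0
    rw [sub_zero] at this
    have h2 := abs_sub_abs_le_abs_sub (f (u x)) (f 0)
    simp only [Real.norm_eq_abs, Pi.add_apply]
    linarith
  refine abs_integral_mul_sub_integral_mul_le (hmem u₁) (hmem u₂) ?_
  filter_upwards [Lp.coeFn_sub u₁ u₂] with x hx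
  rw [hx]
  exact hf _ _

theorem abs_integral_bounded_mul_sub_le {α : Type*} [MeasurableSpace α] {m : Measure α}
    {g : α → ℝ} {C : ℝ} (hg : AEStronglyMeasurable g m) (hC : ∀ᵐ x ∂m, |g x| ≤ C)
    (u₁ u₂ χ : Lp ℝ 2 m) :
    |(∫ x, g x * u₁ x * χ x ∂m) - ∫ x, g x * u₂ x * χ x ∂m| ≤ C * ‖u₁ - u₂‖ * ‖χ‖ := by
  have hmem : ∀ u : Lp ℝ 2 m, MemLp (fun x => g x * u x) 2 m := fun u => by
    refine ((Lp.memLp u).norm.const_mul C).mono' (hg.mul (Lp.aestronglyMeasurable u)) ?_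
    filter_upwards [hC] with x hx
    rw [norm_mul]
    exact mul_le_mul_of_nonneg_right hx (norm_nonneg _)
  refine abs_integral_mul_sub_integral_mul_le (hmem u₁) (hmem u₂) ?_
  filter_upwards [Lp.coeFn_sub u₁ u₂, hC] with x hx hx'
  rw [hx, ← mul_sub, abs_mul]
  exact mul_le_mul_of_nonneg_right hx' (abs_nonneg _)

theorem IsLinfty.exists_ae_slice_bound {d : ℕ} {Θ : Set (EuclideanSpace ℝ (Fin d))} {T : ℝ}
    {g : EuclideanSpace ℝ (Fin d) × ℝ → ℝ} (hg : IsLinfty Θ T g) :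
    ∃ C, 0 ≤ C ∧ ∀ᵐ t ∂volume.restrict (Ioo 0 T),
      AEStronglyMeasurable (fun x => g (x, t)) (volume.restrict Θ) ∧
      ∀ᵐ x ∂volume.restrict Θ, |g (x, t)| ≤ C := by
  obtain ⟨g₁, hm, ⟨C, hC0, hC⟩, hgg⟩ := MemLp.exists_bounded_ae_eq hg
  refine ⟨C, hC0, ?_⟩
  rw [volume_restrict_prod] at hgg
  have h : ∀ᵐ t ∂volume.restrict (Ioo 0 T), ∀ᵐ x ∂volume.restrict Θ, g (x, t) = g₁ (x, t) :=
    Measure.ae_ae_of_ae_prod (Measure.measurePreserving_swap.quasiMeasurePreserving.ae hgg)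
  filter_upwards [h] with t ht
  refine ⟨(hm.comp (measurable_prodMk_right (y := t))).aestronglyMeasurable.congr ?_, ?_⟩
  · filter_upwards [ht] with x hx using hx.symm
  · filter_upwards [ht] with x hx
    rw [hx]
    exact hC _

theorem MeasureTheory.MemLp.integrableOn_Ioo {X : Type*} [NormedAddCommGroup X] {T : ℝ} {u : ℝ → X}
    (hu : MemLp u 2 (volume.restrict (Ioo 0 T))) : IntegrableOn u (Ioo 0 T) :=
  hu.integrable (by norm_num)

theorem MeasureTheory.IntegrableOn.intervalIntegrable_of_mem_Icc {X : Type*}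
    [NormedAddCommGroup X] {T : ℝ} {u : ℝ → X} (hu : IntegrableOn u (Ioo 0 T)) {a b : ℝ}
    (ha : a ∈ Icc 0 T) (hb : b ∈ Icc 0 T) : IntervalIntegrable u volume a b := by
  have : IntegrableOn u (Icc 0 T) :=
    (integrableOn_Icc_iff_integrableOn_Ioo enorm_ne_top enorm_ne_top).2 hu
  exact (this.mono_set (uIcc_subset_Icc ha hb)).intervalIntegrable

theorem L2.continuous_toDual {d : ℕ} {Θ : Set (EuclideanSpace ℝ (Fin d))} :
    Continuous (L2.toDual : L2 Θ → StrongDual ℝ (H10 Θ)) :=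
  (innerSL ℝ).continuous.clm_comp continuous_const

/-- The `L²`-continuous velocity is a primitive of the acceleration, in the weak sense. -/
theorem HasWeakTimeDeriv.inner_sub_toL2_eq_integral {d : ℕ}
    {Θ : Set (EuclideanSpace ℝ (Fin d))} {T : ℝ} (hT : 0 < T) {Ψ : ℝ → L2 Θ}
    {W : ℝ → StrongDual ℝ (H10 Θ)} (h : HasWeakTimeDeriv T (fun t => L2.toDual (Ψ t)) W)
    (hΨ : ContinuousOn Ψ (Icc 0 T)) (hW : IntegrableOn W (Ioo 0 T)) (χ : H10 Θ) {s t : ℝ}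
    (hs : s ∈ Icc 0 T) (ht : t ∈ Icc 0 T) :
    IntervalIntegrable (fun r => W r χ) volume s t ∧
      inner ℝ (Ψ t - Ψ s) (H10.toL2 Θ χ) = ∫ r in s..t, W r χ := by
  have hWi : ∀ {a b : ℝ}, a ∈ Icc 0 T → b ∈ Icc 0 T → IntervalIntegrable W volume a b := by
    intro a b ha hb
    exact hW.intervalIntegrable_of_mem_Icc ha hb
  have h0 : (0 : ℝ) ∈ Icc 0 T := ⟨le_rfl, hT.le⟩
  have hWχ : ∀ {a b : ℝ}, a ∈ Icc 0 T → b ∈ Icc 0 T →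
      IntervalIntegrable (fun r => W r χ) volume a b := fun ha hb =>
    ⟨(ContinuousLinearMap.apply ℝ ℝ χ).integrable_comp (hWi ha hb).1,
      (ContinuousLinearMap.apply ℝ ℝ χ).integrable_comp (hWi ha hb).2⟩
  have key : ∀ r ∈ Icc 0 T, inner ℝ (Ψ r - Ψ 0) (H10.toL2 Θ χ) = ∫ x in (0 : ℝ)..r, W x χ := by
    intro r hr
    have h1 := h.sub_eq_integral hT (L2.continuous_toDual.comp_continuousOn hΨ) hW r hr
    have h2 := congrArg (fun ℓ : StrongDual ℝ (H10 Θ) => ℓ χ) h1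
    have h3 := (ContinuousLinearMap.apply ℝ ℝ χ).intervalIntegral_comp_comm (hWi h0 hr)
    rw [inner_sub_left]
    exact h2.trans h3.symm
  refine ⟨hWχ hs ht, ?_⟩
  rw [← intervalIntegral.integral_interval_sub_left (hWχ h0 ht) (hWχ h0 hs), ← key t ht,
    ← key s hs, ← inner_sub_left, sub_sub_sub_cancel_right]

end

/-! ### Uniqueness of the weak solution. -/

theorem theorem2p2 {d : ℕ} (Θ : Set (EuclideanSpace ℝ (Fin d)))
    (hΘ_open : IsOpen Θ) (hΘ_bdd : Bornology.IsBounded Θ)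
    (T : ℝ) (hT : 0 < T)
    (μ : ℝ → ℝ) (μbar : ℝ) (hμ : MemLp μ ⊤ (volume.restrict (Ioo 0 T))) (hμbar : μbar < 1)
    (hμ_bound : ∀ᵐ t ∂volume.restrict (Ioo 0 T), 0 ≤ μ t ∧ μ t ≤ μbar)
    (ρ β : EuclideanSpace ℝ (Fin d) × ℝ → ℝ)
    (hρ : IsLinfty Θ T ρ) (hβ : IsLinfty Θ T β)
    (β₀ : ℝ) (hβ₀ : 0 < β₀)
    (hβ_ell : ∀ᵐ p ∂volume.restrict (Θ ×ˢ Ioo 0 T), β₀ ≤ β p)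
    (hβ_deriv : ∃ b : EuclideanSpace ℝ (Fin d) × ℝ → ℝ,
      IsLinfty Θ T b ∧ HasWeakPartialTimeDeriv Θ T β b)
    (f : ℝ → ℝ) (Lf : ℝ) (hLf : 0 < Lf)
    (hf : ∀ z₁ z₂ : ℝ, |f z₁ - f z₂| ≤ Lf * |z₁ - z₂|)
    (Q : ℝ → L2 Θ) (hQ : ContinuousOn Q (Icc 0 T))
    (Φ₀ Ψ₀ : L2 Θ) (Φ₁ Φ₂ : ℝ → L2 Θ)
    (h₁ : IsWeakSolution Θ T μ ρ β f Q Φ₀ Ψ₀ Φ₁)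
    (h₂ : IsWeakSolution Θ T μ ρ β f Q Φ₀ Ψ₀ Φ₂) :
    ∀ t ∈ Icc 0 T, Φ₁ t = Φ₂ t := by
  have hfin : IsFiniteMeasure ((volume : Measure (EuclideanSpace ℝ (Fin d))).restrict Θ) := ⟨by
    rw [Measure.restrict_apply_univ]; exact hΘ_bdd.measure_lt_top⟩
  obtain ⟨b, hb, hβb⟩ := hβ_deriv
  obtain ⟨M, γ, hM, hγm, hγM, hγL, hγβ₀, hγβ⟩ :=
    hβb.exists_lipschitz_representative hΘ_open hΘ_bdd hT hβ hb hβ_ell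
  obtain ⟨R, hR0, hR⟩ := hρ.exists_ae_slice_bound
  obtain ⟨κ, hκ0, hκ⟩ := exists_norm_caputo_le (T := T) hμbar (L2 Θ)
  obtain ⟨U₁, V₁, Ψ₁, W₁, ⟨hΦ₁, hU₁, hUΦ₁⟩, ⟨hΦΨ₁, hΨ₁, hV₁, hVΨ₁⟩, ⟨hΨW₁, hW₁⟩, ⟨hi₁, hj₁⟩, heq₁⟩ := h₁
  obtain ⟨U₂, V₂, Ψ₂, W₂, ⟨hΦ₂, hU₂, hUΦ₂⟩, ⟨hΦΨ₂, hΨ₂, hV₂, hVΨ₂⟩, ⟨hΨW₂, hW₂⟩, ⟨hi₂, hj₂⟩, heq₂⟩ := h₂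
  have h0T : (0 : ℝ) ∈ Icc 0 T := ⟨le_rfl, hT.le⟩
  -- Extension by zero makes `v` integrable on the line; below, `ψ` is instead extended by its
  -- endpoint values to stay continuous.
  set v : ℝ → H10 Θ := (Ioo 0 T).indicator (fun t => V₁ t - V₂ t) with hv
  have hvi : Integrable v := (integrable_indicator_iff measurableSet_Ioo).2
    (hV₁.integrableOn_Ioo.sub hV₂.integrableOn_Ioo)
  have hΨsub : ContinuousOn (fun t => Ψ₁ t - Ψ₂ t) (Icc 0 T) := hΨ₁.sub hΨ₂
  set ψ : ℝ → L2 Θ := IccExtend hT.le ((Icc 0 T).domRestrict fun t => Ψ₁ t - Ψ₂ t) with hψ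
  have hψc : Continuous ψ := hΨsub.domRestrict.Icc_extend'
  have hψe : ∀ t ∈ Icc 0 T, ψ t = Ψ₁ t - Ψ₂ t := fun t ht => by
    rw [hψ, IccExtend_of_mem _ _ ht]; rfl
  have hjv : ∀ᵐ t, t ∈ Ioo 0 T → H10.toL2 Θ (v t) = ψ t := by
    filter_upwards [(ae_restrict_iff' measurableSet_Ioo).1 hVΨ₁,
      (ae_restrict_iff' measurableSet_Ioo).1 hVΨ₂] with t h1 h2 ht
    rw [hψe t (Ioo_subset_Icc_self ht), hv, indicator_of_mem ht, map_sub, h1 ht, h2 ht]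
  have hΨi : ∀ {Ψ : ℝ → L2 Θ}, ContinuousOn Ψ (Icc 0 T) → ∀ {t : ℝ}, t ∈ Icc 0 T →
      IntervalIntegrable Ψ volume 0 t := fun h t ht =>
    (h.mono (uIcc_subset_Icc h0T ht)).intervalIntegrable
  have hφ : ∀ t ∈ Icc 0 T, Φ₁ t - Φ₂ t = ∫ s in (0 : ℝ)..t, ψ s := by
    intro t ht
    have hint : ∀ {Ψ : ℝ → L2 Θ}, ContinuousOn Ψ (Icc 0 T) → IntegrableOn Ψ (Ioo 0 T) := fun h =>
      (h.integrableOn_compact isCompact_Icc).mono_set Ioo_subset_Icc_self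
    have e1 := hΦΨ₁.sub_eq_integral hT hΦ₁ (hint hΨ₁) t ht
    have e2 := hΦΨ₂.sub_eq_integral hT hΦ₂ (hint hΨ₂) t ht
    have e3 : ∫ s in (0 : ℝ)..t, ψ s = ∫ s in (0 : ℝ)..t, (Ψ₁ s - Ψ₂ s) :=
      intervalIntegral.integral_congr fun s hs => hψe s (uIcc_subset_Icc h0T ht hs)
    rw [e3, intervalIntegral.integral_sub (hΨi hΨ₁ ht) (hΨi hΨ₂ ht), ← e1, ← e2, hi₁, hi₂]
    abel
  have hju : ∀ t ∈ Icc 0 T, H10.toL2 Θ (∫ s in (0 : ℝ)..t, v s) = Φ₁ t - Φ₂ t := by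
    intro t ht
    rw [hφ t ht, ← (H10.toL2 Θ).intervalIntegral_comp_comm hvi.intervalIntegrable]
    refine intervalIntegral.integral_congr_ae ?_
    filter_upwards [hjv, compl_mem_ae_iff.2 (measure_singleton T)] with s hs hsT hst
    rw [uIoc_of_le ht.1] at hst
    exact hs ⟨hst.1, lt_of_le_of_ne (hst.2.trans ht.2) hsT⟩
  -- Both sides have the same image in `L²`. Hence the gradient of the difference is the primitive
  -- of `∇v`, as the abstract result requires.
  have hu : ∀ᵐ t ∂volume.restrict (Ioo 0 T), U₁ t - U₂ t = ∫ s in (0 : ℝ)..t, v s := by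
    filter_upwards [hUΦ₁, hUΦ₂, ae_restrict_mem measurableSet_Ioo] with t h1 h2 ht
    refine H10.toL2_injective hΘ_open ?_
    rw [hju t (Ioo_subset_Icc_self ht), map_sub, h1, h2]
  have hγmem : ∀ t, MemLp (γ t) ⊤ (volume.restrict Θ) := fun t =>
    memLp_top_of_bound (hγm t).aestronglyMeasurable M (ae_of_all _ (hγM t))
  set A : ℝ → L2Vec Θ →L[ℝ] L2Vec Θ := fun t => L2Vec.mulOp (hγmem t) with hA
  have hψ0 : ∀ t ∈ Icc 0 T, ψ t = 0 := by
    refine eq_zero_of_weak_equation (H10.toL2 Θ) (H10.grad Θ) hvi hψc ?_ hjv (A := A) hM hβ₀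
      (fun s t => L2Vec.norm_mulOp_sub_le _ _ (by positivity) (hγL s t))
      (fun t => L2Vec.inner_mulOp_comm _)
      (fun t => L2Vec.mul_norm_sq_le_inner_mulOp _ (hγβ₀ t))
      -- `R` bounds `ρ` and `κ` the Caputo operator; `Lf * T` comes from `‖Φ₁ r - Φ₂ r‖ ≤ T q(r)`.
      (c := R * κ + Lf * T) (by positivity) ?_
    · rw [hψe 0 h0T, hj₁, hj₂, sub_self]
    intro q hqc hqm hq0 hψq χ s t hs hst ht
    have hsI : s ∈ Icc 0 T := ⟨hs, hst.trans ht⟩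
    have htI : t ∈ Icc 0 T := ⟨hs.trans hst, ht⟩
    obtain ⟨i1, w1⟩ := hΨW₁.inner_sub_toL2_eq_integral hT hΨ₁ hW₁.integrableOn_Ioo χ hsI htI
    obtain ⟨i2, w2⟩ := hΨW₂.inner_sub_toL2_eq_integral hT hΨ₂ hW₂.integrableOn_Ioo χ hsI htI
    have hlhs : inner ℝ (ψ t - ψ s) (H10.toL2 Θ χ) = ∫ r in s..t, (W₁ r χ - W₂ r χ) := by
      rw [intervalIntegral.integral_sub i1 i2, ← w1, ← w2, hψe t htI, hψe s hsI, ← inner_sub_left]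
      congr 1
      abel
    rw [hlhs]
    have hAc : Continuous A := continuous_of_norm_sub_le (M := M) fun s t =>
      L2Vec.norm_mulOp_sub_le _ _ (by positivity) (hγL s t)
    have hûc : Continuous fun r => ∫ x in (0 : ℝ)..r, v x :=
      intervalIntegral.continuous_primitive (fun _ _ => hvi.intervalIntegrable) 0
    have hGc : Continuous fun r => A r (H10.grad Θ (∫ x in (0 : ℝ)..r, v x)) :=
      hAc.clm_apply ((H10.grad Θ).continuous.comp hûc)
    refine intervalIntegral.integral_mono_ae_restrict hst (i1.sub i2)
      (Continuous.intervalIntegrable (by fun_prop) _ _) ?_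
    have hpt : ∀ᵐ r ∂volume.restrict (Ioo 0 T), W₁ r χ - W₂ r χ ≤
        -inner ℝ (A r (H10.grad Θ (∫ x in (0 : ℝ)..r, v x))) (H10.grad Θ χ) +
          (R * κ + Lf * T) * q r * ‖H10.toL2 Θ χ‖ := by
      filter_upwards [heq₁ χ, heq₂ χ, hγβ, hR, hμ_bound, hu, ae_restrict_mem measurableSet_Ioo]
        with r e1 e2 hγr hRr hμr hur hr
      have hrI := Ioo_subset_Icc_self hr
      have hsub : uIcc 0 r ⊆ Icc 0 T := uIcc_subset_Icc h0T hrI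
      have eβ : ∀ u : H10 Θ, ∫ x in Θ, β (x, r) * inner ℝ (H10.grad Θ u x) (H10.grad Θ χ x) =
          inner ℝ (A r (H10.grad Θ u)) (H10.grad Θ χ) := fun u => by
        rw [hA, L2Vec.inner_mulOp]
        refine integral_congr_ae ?_
        filter_upwards [hγr] with x hx
        rw [hx]
      rw [eβ] at e1 e2
      have hψqr : ∀ x ∈ Icc 0 r, ‖Ψ₁ x - Ψ₂ x‖ ≤ q r := fun x hx => by
        have hxI : x ∈ Icc 0 T := ⟨hx.1, hx.2.trans hrI.2⟩
        rw [← hψe x hxI]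
        exact (hψq x hxI).trans (hqm hx.2)
      have hcap : ‖caputo μ Ψ₁ r - caputo μ Ψ₂ r‖ ≤ κ * q r := by
        rw [← caputo_sub (hμr.2.trans_lt hμbar) (hΨ₁.mono hsub) (hΨ₂.mono hsub)]
        exact hκ μ _ r (q r) hμr hrI hψqr
      have hΦr : ‖Φ₁ r - Φ₂ r‖ ≤ T * q r := by
        rw [hφ r hrI]
        refine (intervalIntegral.norm_integral_le_of_norm_le_const (C := q r) fun x hx => ?_).trans ?_
        · rw [uIoc_of_le hr.1.le] at hx
          rw [hψe x ⟨hx.1.le, hx.2.trans hrI.2⟩]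
          exact hψqr x ⟨hx.1.le, hx.2⟩
        · rw [sub_zero, abs_of_pos hr.1, mul_comm]
          exact mul_le_mul_of_nonneg_right hr.2.le (hq0 r)
      have bρ := abs_integral_bounded_mul_sub_le hRr.1 hRr.2 (caputo μ Ψ₁ r) (caputo μ Ψ₂ r)
        (H10.toL2 Θ χ)
      have bf := abs_integral_lipschitz_comp_sub_le hLf.le hf (Φ₁ r) (Φ₂ r) (H10.toL2 Θ χ)
      have bρ' : R * ‖caputo μ Ψ₁ r - caputo μ Ψ₂ r‖ * ‖H10.toL2 Θ χ‖ ≤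
          R * (κ * q r) * ‖H10.toL2 Θ χ‖ := by gcongr
      have bf' : Lf * ‖Φ₁ r - Φ₂ r‖ * ‖H10.toL2 Θ χ‖ ≤ Lf * (T * q r) * ‖H10.toL2 Θ χ‖ := by gcongr
      have eG : inner ℝ (A r (H10.grad Θ (∫ x in (0 : ℝ)..r, v x))) (H10.grad Θ χ) =
          inner ℝ (A r (H10.grad Θ (U₁ r))) (H10.grad Θ χ) -
            inner ℝ (A r (H10.grad Θ (U₂ r))) (H10.grad Θ χ) := by
        rw [← hur, map_sub, map_sub, inner_sub_left]
      rw [eG]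
      have bρ'' := (neg_abs_le _).trans' (neg_le_neg (bρ.trans bρ'))
      have bf'' := (le_abs_self _).trans (bf.trans bf')
      linarith
    have hsubI : ∀ᵐ r, r ∈ Icc s t → r ∈ Ioo 0 T := by
      filter_upwards [compl_mem_ae_iff.2 (measure_singleton (0 : ℝ)),
        compl_mem_ae_iff.2 (measure_singleton T)] with r h0 hT' hr
      exact ⟨lt_of_le_of_ne (hs.trans hr.1) (Ne.symm h0), lt_of_le_of_ne (hr.2.trans ht) hT'⟩
    rw [Filter.EventuallyLE, ae_restrict_iff' measurableSet_Icc]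
    filter_upwards [hsubI, (ae_restrict_iff' measurableSet_Ioo).1 hpt] with r hr1 hr2 hr
    exact hr2 (hr1 hr)
  intro t ht
  rw [← sub_eq_zero, hφ t ht]
  refine (intervalIntegral.integral_congr (g := fun _ => (0 : L2 Θ)) fun s hs =>
    hψ0 s (uIcc_subset_Icc h0T ht hs)).trans (by simp)
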